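/- **Notation.** Let $n\ge 2$ and equip $\mathbb R^n$ with its canonical Euclidean structure. A subspace of $\mathbb R^n$ is *rational* if it has a basis of vectors with rational coordinates; $\mathfrak R_n(e)$ is the set of rational subspaces of dimension $e$. The *height* $H(B)$ of $B\in\mathfrak R_n(e)$ is the Euclidean norm of a vector of Plücker coordinates of $B$ (the $e\times e$ minors of the matrix of a basis of $B$, up to a common scalar factor) chosen with coprime integer entries. For nonzero $X,Y\in\mathbb R^n$ let $\psi(X,Y)$ be the sine of the angle between $X$ and $Y$. For subspaces $A,B$ of dimensions $d,e\geq 1$, put $A_0=A$, $B_0=B$ and, for $1\le j\le\min(d,e)$, let $$\psi_j(A,B)=\min\{\psi(X,Y): X\in A_{j-1}\setminus\{0\},\ Y\in B_{j-1}\setminus\{0\}\},$$ let $X_j\in A_{j-1}$, $Y_j\in B_{j-1}$ be unit vectors realizing this minimum, and let $A_j$ (resp. $B_j$) be the orthogonal complement of $\mathrm{span}(X_1,\dots,X_j)$ in $A$ (resp. of $\mathrm{span}(Y_1,\dots,Y_j)$ in $B$). The number $\psi_j(A,B)$ does not depend on the choices made. For $d,e\ge1$ with $d+e\le n$ and $1\le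 j\le\min(d,e)$, let $\mathfrak I_n(d,e)_j$ be the set of subspaces $A$ of $\mathbb R^n$ of dimension $d$ such that $\dim(A\cap B)<j$ for all $B\in\mathfrak R_n(e)$. For such an $A$, let $\mu_n(A|e)_j\in[0,+\infty]$ be the supremum of the real numbers $\beta>0$ such that $$\psi_j(A,B)\le \frac1{H(B)^{\beta}}$$ for infinitely many $B\in\mathfrak R_n(e)$, and let $$\mathring\mu_n(d|e)_j=\inf_{A\in\mathfrak I_n(d,e)_j}\mu_n(A|e)_j .$$ **Theorem.** 1. Let $n\ge 4$ and $d,e\in\{1,\dots,n-1\}$ with $d+e\le n$, and let $j\in\{1,\dots,\min(d,e)\}$. Then $$\mathring\mu_n(d|e)_j\ \ge\ \frac{(n-j)\left(jn-jd+\frac{j^2}{2}+\frac j2+1\right)}{j^2(n-e)\left(n-d+\frac j2+\frac12\right)}.$$ 2. In particular, for all integers $n\ge4$ and $1\le d\le n/2$, $$\mathring\mu_n(d|d)_d\ \ge\ \frac{2dn-d^2+d+2}{2d^2n-d^3+d^2}.$$ 3. For fixed integers $d,e,j$ with $1\le j\le \min(d,e)$, the lower bound in 1 tends to $\frac1j$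 as $n\to\infty$. -/

import Mathlib

open Filter Topology

noncomputable section

namespace SubspaceApprox

/-- The Euclidean space `ℝⁿ`. -/
abbrev E (n : ℕ) : Type := EuclideanSpace ℝ (Fin n)

/-- A vector of `ℚⁿ`, seen in `ℝⁿ`. -/
def ratVec {n : ℕ} (v : Fin n → ℚ) : E n := WithLp.toLp 2 (fun k => (v k : ℝ))

/-- A subspace of `ℝⁿ` is rational if it has a basis made of vectors with rational coordinates. -/
def IsRational {n : ℕ} (B : Submodule ℝ (E n)) : Prop :=
  ∃ (m : ℕ) (v : Fin m → Fin n → ℚ),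
    LinearIndependent ℝ (fun i => ratVec (v i)) ∧
      Submodule.span ℝ (Set.range (fun i => ratVec (v i))) = B

/-- The set of the rational subspaces of `ℝⁿ` of dimension `e`. -/
def rationalSubspaces (n e : ℕ) : Set (Submodule ℝ (E n)) :=
  {B | IsRational B ∧ Module.finrank ℝ B = e}

/-- The set of the `(e, j)`-irrational subspaces of `ℝⁿ` of dimension `d`: those which meet every
rational subspace of dimension `e` in a subspace of dimension less than `j`. -/
def irrationalSubspaces (n d e j : ℕ) : Set (Submodule ℝ (E n)) :=
  {A | Module.finrank ℝ A = d ∧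
    ∀ B ∈ rationalSubspaces n e, Module.finrank ℝ (A ⊓ B : Submodule ℝ (E n)) < j}

/-! ### Height -/

/-- The subsets of `{1, …, n}` with `e` elements. -/
abbrev PluckerIndex (n e : ℕ) : Type := {I : Finset (Fin n) // I.card = e}

/-- The Plücker coordinates attached to `e` vectors of `ℝⁿ`: the minors of size `e × e` of the
matrix whose columns are these vectors. -/
def pluckerCoords {n e : ℕ} (v : Fin e → E n) (I : PluckerIndex n e) : ℝ :=
  Matrix.det (Matrix.of fun r c : Fin e => v c (I.1.orderEmbOfFin I.2 r))

/-- `ξ` is a representative, with coprime integer coordinates, of the Plücker coordinates of the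
subspace `B` of dimension `e`. -/
def IsPrimitivePlucker {n e : ℕ} (B : Submodule ℝ (E n)) (ξ : PluckerIndex n e → ℤ) : Prop :=
  Finset.univ.gcd ξ = 1 ∧
    ∃ v : Fin e → E n, LinearIndependent ℝ v ∧ Submodule.span ℝ (Set.range v) = B ∧
      ∃ c : ℝ, c ≠ 0 ∧ ∀ I, (ξ I : ℝ) = c * pluckerCoords v I

/-- The height of a rational subspace `B` of dimension `e`: the Euclidean norm of a representative
of its Plücker coordinates with coprime integer coordinates. Such a representative is unique up to
sign, so that its choice does not matter. -/
def height {n : ℕ} (e : ℕ) (B : Submodule ℝ (E n)) : ℝ :=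
  Real.sqrt (∑ I, ((Classical.epsilon fun ξ : PluckerIndex n e → ℤ => IsPrimitivePlucker B ξ) I
    : ℝ) ^ 2)

/-! ### Proximity -/

/-- The sine of the geometric angle between two nonzero vectors. -/
def sinAngle {n : ℕ} (X Y : E n) : ℝ := Real.sin (InnerProductGeometry.angle X Y)

/-- The least sine of an angle between a nonzero vector of `A` and a nonzero vector of `B`. -/
def minSine {n : ℕ} (A B : Submodule ℝ (E n)) : ℝ :=
  sInf {s | ∃ X ∈ A, X ≠ 0 ∧ ∃ Y ∈ B, Y ≠ 0 ∧ s = sinAngle X Y}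

/-- `X` and `Y` are unit vectors of `A` and `B` which realize the minimum `minSine A B`. -/
def IsMinimizingPair {n : ℕ} (A B : Submodule ℝ (E n)) (p : E n × E n) : Prop :=
  p.1 ∈ A ∧ p.2 ∈ B ∧ ‖p.1‖ = 1 ∧ ‖p.2‖ = 1 ∧ sinAngle p.1 p.2 = minSine A B

/-- A choice of unit vectors of `A` and `B` which realize the minimum `minSine A B`. -/
def minimizingPair {n : ℕ} (A B : Submodule ℝ (E n)) : E n × E n :=
  Classical.epsilon fun p => IsMinimizingPair A B p

/-- The subspaces `(A_j, B_j)`: one has `(A_0, B_0) = (A, B)`, and `A_{j+1}`, `B_{j+1}` are the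
orthogonal complements in `A_j`, `B_j` of chosen unit vectors `X_{j+1}`, `Y_{j+1}` which realize the
minimum of the sine of an angle between `A_j` and `B_j`. Thus `A_j` is the orthogonal complement
in `A` of the span of `X_1, …, X_j`, and `B_j` that in `B` of the span of `Y_1, …, Y_j`. -/
def residual {n : ℕ} (A B : Submodule ℝ (E n)) : ℕ → Submodule ℝ (E n) × Submodule ℝ (E n)
  | 0 => (A, B)
  | j + 1 =>
    ((residual A B j).1 ⊓
        (Submodule.span ℝ {(minimizingPair (residual A B j).1 (residual A B j).2).1})ᗮ,
      (residual A B j).2 ⊓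
        (Submodule.span ℝ {(minimizingPair (residual A B j).1 (residual A B j).2).2})ᗮ)

/-- `psi A B j` is the sine of the `j`-th canonical angle between `A` and `B`, for
`1 ≤ j ≤ min (dim A) (dim B)` (the value at `j = 0` plays no role). -/
def psi {n : ℕ} (A B : Submodule ℝ (E n)) : ℕ → ℝ
  | 0 => 0
  | j + 1 => minSine (residual A B j).1 (residual A B j).2

/-- The minimum in the definition of the angles is attained. -/
theorem exists_isMinimizingPair {n : ℕ} (A B : Submodule ℝ (E n)) (hA : A ≠ ⊥) (hB : B ≠ ⊥) :
    ∃ p, IsMinimizingPair A B p := by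
  obtain ⟨a, haA, ha0⟩ := Submodule.exists_mem_ne_zero_of_ne_bot hA
  obtain ⟨b, hbB, hb0⟩ := Submodule.exists_mem_ne_zero_of_ne_bot hB
  have unit : ∀ (S : Submodule ℝ (E n)) (x : E n), x ∈ S → x ≠ 0 →
      (‖x‖⁻¹ • x ∈ (S : Set (E n)) ∩ Metric.sphere 0 1) := by
    intro S x hx h0
    refine ⟨S.smul_mem _ hx, ?_⟩
    simp [norm_smul, h0]
  have hcomp : ∀ S : Submodule ℝ (E n), IsCompact ((S : Set (E n)) ∩ Metric.sphere 0 1) :=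
    fun S => (isCompact_sphere 0 1).inter_left S.closed_of_finiteDimensional
  have hcont : ContinuousOn (fun p : E n × E n => sinAngle p.1 p.2)
      (((A : Set (E n)) ∩ Metric.sphere 0 1) ×ˢ ((B : Set (E n)) ∩ Metric.sphere 0 1)) := by
    rintro ⟨x, y⟩ ⟨hx, hy⟩
    have hx0 : x ≠ 0 := by rintro rfl; simpa using hx.2
    have hy0 : y ≠ 0 := by rintro rfl; simpa using hy.2
    exact (Real.continuous_sin.continuousAt.comp
      (InnerProductGeometry.continuousAt_angle hx0 hy0)).continuousWithinAt
  obtain ⟨p, hp, hmin⟩ := ((hcomp A).prod (hcomp B)).exists_isMinOn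
    ⟨(‖a‖⁻¹ • a, ‖b‖⁻¹ • b), unit A a haA ha0, unit B b hbB hb0⟩ hcont
  have h1 : ‖p.1‖ = 1 := by simpa using hp.1.2
  have h2 : ‖p.2‖ = 1 := by simpa using hp.2.2
  refine ⟨p, hp.1.1, hp.2.1, h1, h2, (IsLeast.csInf_eq ⟨?_, ?_⟩).symm⟩
  · refine ⟨p.1, hp.1.1, ?_, p.2, hp.2.1, ?_, rfl⟩
    · intro h; simp [h] at h1
    · intro h; simp [h] at h2
  · rintro s ⟨x, hx, hx0, y, hy, hy0, rfl⟩
    have := hmin (show (‖x‖⁻¹ • x, ‖y‖⁻¹ • y) ∈ _ from ⟨unit A x hx hx0, unit B y hy hy0⟩)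
    simpa [sinAngle, InnerProductGeometry.angle_smul_left_of_pos,
      InnerProductGeometry.angle_smul_right_of_pos, hx0, hy0] using this

/-! ### Exponents -/

/-- The supremum, in the extended reals, of the real numbers `β > 0` such that
`psi A B j ≤ 1 / H(B) ^ β` for infinitely many rational subspaces `B` of dimension `e`. -/
def muExponent {n : ℕ} (A : Submodule ℝ (E n)) (e j : ℕ) : EReal :=
  sSup ((fun β : ℝ => (β : EReal)) '' {β : ℝ | 0 < β ∧
    {B ∈ rationalSubspaces n e | psi A B j ≤ 1 / height e B ^ β}.Infinite})

/-- The infimum of `muExponent A e j` over the `(e, j)`-irrational subspaces `A` of `ℝⁿ` of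
dimension `d`. -/
def muInf (n d e j : ℕ) : EReal :=
  ⨅ A ∈ irrationalSubspaces n d e j, muExponent A e j

end SubspaceApprox

end

/-! Fix an irrational `A` of dimension `d`. Row reduction gives `A` a basis in echelon form with
entries bounded by 1. Dirichlet's theorem, applied to the `j(n-d)` entries of `j` of these vectors
outside the pivot rows, yields `q ≤ Q^(j(n-d))` and `j` integral vectors within `1/Q` of `q` times
the basis vectors. They span a rational `B` of dimension `j` with `H(B) ≪ q^j`. A vector `Y` of `B`
has coefficients at most `‖Y‖/q` on them, so its distance to `A` is `≪ ‖Y‖/(qQ)`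
(`exists_mem_rationalSubspaces_approx`).

Going up (`exists_mem_rationalSubspaces_ge`) embeds `B` in a rational `C` of dimension `e` with
`H(C) ≪ H(B)^θ`, where `θ = (n-e)/(n-j)`. One dimension is added at a time: the integral points of a
rational subspace of dimension `f` form, in pivot coordinates, a sublattice of `ℤ^f` whose index `N`
satisfies `H ≪ N`. Pigeonhole over the `N` classes produces an integral vector outside the subspace
at distance `≪ N^(-1/(n-f))` from it, and adjoining this vector multiplies the height by `≪
H^(-1/(n-f))`.

Since `C` contains a `j`-dimensional subspace close to `A`, `psi A C j ≪ 1/(qQ)`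
(`psi_le_of_forall_mem_exists_norm_sub_le`). As `Q ≥ q^(1/(j(n-d)))`, every `β` with `jθβ = 1 + κ`
and `κ < 1/(j(n-d))` is admissible: the slack absorbs the constants. The stated bound is the case `κ
= 1/(j(n-d+(j+1)/2))`. Infinitely many `C` occur because `psi A C j` tends to 0 as `Q` grows but
never vanishes, by irrationality (`psi_pos_of_mem_irrationalSubspaces`). -/

noncomputable section

namespace SubspaceApprox

section

variable {n : ℕ}

/-! ### Canonical angles -/

theorem sinAngle_nonneg (X Y : E n) : 0 ≤ sinAngle X Y :=
  InnerProductGeometry.sin_angle_nonneg X Y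

theorem sinAngle_le_of_norm_sub_le {X Y : E n} (hX : X ≠ 0) (hY : Y ≠ 0) {ε : ℝ}
    (h : ‖Y - X‖ ≤ ε * ‖Y‖) : sinAngle X Y ≤ ε := by
  have hX' : 0 < ‖X‖ := norm_pos_iff.2 hX
  have hY' : 0 < ‖Y‖ := norm_pos_iff.2 hY
  have h1 := InnerProductGeometry.sin_angle_mul_norm_mul_norm X Y
  have h2 : √(inner ℝ X X * inner ℝ Y Y - inner ℝ X Y * inner ℝ X Y) ≤ ‖X‖ * ‖Y - X‖ := by
    refine Real.sqrt_le_iff.2 ⟨by positivity, ?_⟩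
    have h3 := norm_sub_sq_real Y X
    rw [real_inner_self_eq_norm_sq, real_inner_self_eq_norm_sq, mul_pow, h3, real_inner_comm]
    -- The difference of the two sides is exactly this square.
    nlinarith [sq_nonneg (inner ℝ Y X - ‖X‖ ^ 2)]
  have h4 : sinAngle X Y * (‖X‖ * ‖Y‖) ≤ ε * (‖X‖ * ‖Y‖) := by
    calc sinAngle X Y * (‖X‖ * ‖Y‖) ≤ ‖X‖ * ‖Y - X‖ := by unfold sinAngle; rw [h1]; exact h2
      _ ≤ ‖X‖ * (ε * ‖Y‖) := by gcongr
      _ = ε * (‖X‖ * ‖Y‖) := by ring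
  exact le_of_mul_le_mul_right h4 (by positivity)

theorem minSine_le {A B : Submodule ℝ (E n)} {X Y : E n} (hX : X ∈ A) (hX0 : X ≠ 0) (hY : Y ∈ B)
    (hY0 : Y ≠ 0) : minSine A B ≤ sinAngle X Y := by
  refine csInf_le ⟨0, ?_⟩ ⟨X, hX, hX0, Y, hY, hY0, rfl⟩
  rintro _ ⟨X, -, -, Y, -, -, rfl⟩
  exact sinAngle_nonneg X Y

theorem minSine_nonneg (A B : Submodule ℝ (E n)) : 0 ≤ minSine A B := by
  refine Real.sInf_nonneg ?_
  rintro _ ⟨X, -, -, Y, -, -, rfl⟩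
  exact sinAngle_nonneg X Y

theorem minSine_mono {A A' B B' : Submodule ℝ (E n)} (hA : A' ≤ A) (hB : B' ≤ B) (hA' : A' ≠ ⊥)
    (hB' : B' ≠ ⊥) : minSine A B ≤ minSine A' B' := by
  obtain ⟨p, h1, h2, h3, h4, h5⟩ := exists_isMinimizingPair A' B' hA' hB'
  rw [← h5]
  exact minSine_le (hA h1) (by intro h; simp [h] at h3) (hB h2) (by intro h; simp [h] at h4)

theorem isMinimizingPair_minimizingPair {A B : Submodule ℝ (E n)} (hA : A ≠ ⊥) (hB : B ≠ ⊥) :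
    IsMinimizingPair A B (minimizingPair A B) :=
  Classical.epsilon_spec (exists_isMinimizingPair A B hA hB)

/-- A minimal sine is a maximal squared cosine. -/
theorem IsMinimizingPair.inner_sq_le {A B : Submodule ℝ (E n)} {p : E n × E n}
    (hp : IsMinimizingPair A B p) {Y : E n} (hY : Y ∈ B) :
    inner ℝ p.1 Y ^ 2 ≤ inner ℝ p.1 p.2 ^ 2 * ‖Y‖ ^ 2 := by
  obtain ⟨h1, h2, h3, h4, h5⟩ := hp
  rcases eq_or_ne Y 0 with rfl | hY0
  · simp
  have hX0 : p.1 ≠ 0 := by intro h; simp [h] at h3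
  have h6 := minSine_le h1 hX0 hY hY0
  rw [← h5] at h6
  have h7 : sinAngle p.1 p.2 ^ 2 ≤ sinAngle p.1 Y ^ 2 :=
    pow_le_pow_left₀ (sinAngle_nonneg _ _) h6 2
  unfold sinAngle at h7
  rw [Real.sin_sq, Real.sin_sq, InnerProductGeometry.cos_angle, InnerProductGeometry.cos_angle,
    h3, h4] at h7
  have hY' : 0 < ‖Y‖ := norm_pos_iff.2 hY0
  have h8 : (inner ℝ p.1 Y / (1 * ‖Y‖)) ^ 2 ≤ (inner ℝ p.1 p.2 / (1 * 1)) ^ 2 := by linarith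
  rw [one_mul, div_pow, div_le_iff₀ (by positivity)] at h8
  simpa using h8

/-- A vector of `B` orthogonal to the second vector of a minimizing pair is orthogonal to the
first one. -/
theorem IsMinimizingPair.inner_eq_zero {A B : Submodule ℝ (E n)} {p : E n × E n}
    (hp : IsMinimizingPair A B p) {Y : E n} (hY : Y ∈ B) (h0 : inner ℝ p.2 Y = 0) :
    inner ℝ p.1 Y = 0 := by
  by_contra hs
  -- First-order optimality: `p.2` maximizes the squared cosine with `p.1` over `B`, so it is
  -- compared with its perturbations `p.2 + t • Y`.
  have key : ∀ t : ℝ, (inner ℝ p.1 p.2 + t * inner ℝ p.1 Y) ^ 2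
      ≤ inner ℝ p.1 p.2 ^ 2 * (1 + t ^ 2 * ‖Y‖ ^ 2) := by
    intro t
    have h := hp.inner_sq_le (B.add_mem hp.2.1 (B.smul_mem t hY))
    have h9 : ‖p.2 + t • Y‖ ^ 2 = 1 + t ^ 2 * ‖Y‖ ^ 2 := by
      rw [norm_add_sq_real, inner_smul_right, h0, hp.2.2.2.1, norm_smul, mul_pow]
      simp
    rwa [inner_add_right, inner_smul_right, h9] at h
  set c := inner ℝ p.1 p.2
  set s := inner ℝ p.1 Y
  rcases eq_or_ne c 0 with hc | hc
  · have := key 1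
    rw [hc] at this
    have : 0 < s ^ 2 := by positivity
    nlinarith
  · have hs2 : 0 < (c * s) ^ 2 := by positivity
    have hK : 0 < c ^ 2 * ‖Y‖ ^ 2 + 1 := by positivity
    -- With this `t` the linear term `2cst` is positive and outweighs the quadratic term on the
    -- right.
    have := key (c * s / (c ^ 2 * ‖Y‖ ^ 2 + 1))
    set t := c * s / (c ^ 2 * ‖Y‖ ^ 2 + 1) with ht
    have h1 : t * (c ^ 2 * ‖Y‖ ^ 2 + 1) = c * s := by rw [ht]; field_simp
    have h2 : 2 * (c * s) * t ≤ c ^ 2 * ‖Y‖ ^ 2 * t * t := by nlinarith [sq_nonneg (t * s)]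
    have h3 : c ^ 2 * ‖Y‖ ^ 2 * t = c * s - t := by linarith
    rw [h3] at h2
    have h4 : 0 < (c * s) * t := by
      rw [ht, show c * s * (c * s / (c ^ 2 * ‖Y‖ ^ 2 + 1)) = (c * s) ^ 2 / (c ^ 2 * ‖Y‖ ^ 2 + 1) by
        ring]
      positivity
    nlinarith [sq_nonneg t]

theorem residual_succ (A B : Submodule ℝ (E n)) (i : ℕ) :
    residual A B (i + 1) = residual (residual A B 1).1 (residual A B 1).2 i := by
  induction i with
  | zero => rfl
  | succ i ih => rw [residual, ih]; rfl

theorem psi_succ_succ (A B : Submodule ℝ (E n)) (i : ℕ) :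
    psi A B (i + 2) = psi (residual A B 1).1 (residual A B 1).2 (i + 1) := by
  rw [psi, psi, residual_succ]

theorem psi_one (A B : Submodule ℝ (E n)) : psi A B 1 = minSine A B := rfl

theorem finrank_le_finrank_inf_orthogonal_add_one (S : Submodule ℝ (E n)) (X : E n) :
    Module.finrank ℝ S
      ≤ Module.finrank ℝ (S ⊓ (Submodule.span ℝ {X})ᗮ : Submodule ℝ (E n)) + 1 := by
  have h1 := Submodule.finrank_sup_add_finrank_inf_eq S (Submodule.span ℝ {X})ᗮ
  have h2 := Submodule.finrank_add_finrank_orthogonal (Submodule.span ℝ {X})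
  have h3 := finrank_span_le_card (R := ℝ) ({X} : Set (E n))
  have h4 := Submodule.finrank_le (S ⊔ (Submodule.span ℝ {X})ᗮ)
  simp only [Set.toFinset_singleton, Finset.card_singleton] at h3
  omega

theorem ne_bot_of_one_le_finrank {S : Submodule ℝ (E n)} (h : 1 ≤ Module.finrank ℝ S) : S ≠ ⊥ := by
  rintro rfl
  simp at h

theorem psi_nonneg (A B : Submodule ℝ (E n)) (j : ℕ) : 0 ≤ psi A B j := by
  cases j with
  | zero => exact le_rfl
  | succ j => exact minSine_nonneg _ _

/-- If every vector of a subspace of `B` of dimension `j` is close to `A`, then the `j`-th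
canonical angle between `A` and `B` is small. -/
theorem psi_le_of_forall_mem_exists_norm_sub_le {j : ℕ} (hj : 1 ≤ j) {A B B' : Submodule ℝ (E n)}
    (hA : j ≤ Module.finrank ℝ A) (hB' : j ≤ Module.finrank ℝ B') (hB : B' ≤ B) {ε : ℝ}
    (h : ∀ Y ∈ B', ∃ X ∈ A, ‖Y - X‖ ≤ ε * ‖Y‖) : psi A B j ≤ ε := by
  induction j, hj using Nat.le_induction generalizing A B B' with
  | base =>
    rw [psi_one]
    obtain ⟨Y, hY, hY0⟩ := Submodule.exists_mem_ne_zero_of_ne_bot (ne_bot_of_one_le_finrank hB')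
    obtain ⟨X, hX, hXY⟩ := h Y hY
    -- If `X = 0`, the hypothesis forces `ε ≥ 1` and any nonzero vector of `A` will do.
    rcases eq_or_ne X 0 with rfl | hX0
    · obtain ⟨X, hX, hX0⟩ := Submodule.exists_mem_ne_zero_of_ne_bot (ne_bot_of_one_le_finrank hA)
      refine (minSine_le hX hX0 (hB hY) hY0).trans ((Real.sin_le_one _).trans ?_)
      rw [sub_zero] at hXY
      exact le_of_mul_le_mul_right (by simpa using hXY) (norm_pos_iff.2 hY0)
    · exact (minSine_le hX hX0 (hB hY) hY0).trans (sinAngle_le_of_norm_sub_le hX0 hY0 hXY)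
  | succ j hj ih =>
    have hp : IsMinimizingPair A B (minimizingPair A B) :=
      isMinimizingPair_minimizingPair (ne_bot_of_one_le_finrank (by omega))
        (ne_bot_of_le_ne_bot (ne_bot_of_one_le_finrank (S := B') (by omega)) hB)
    obtain ⟨i, rfl⟩ := Nat.exists_eq_add_of_le' hj
    rw [psi_succ_succ]
    set p := minimizingPair A B with hpdef
    have h1 : (residual A B 1).1 = A ⊓ (Submodule.span ℝ {p.1})ᗮ := rfl
    have h2 : (residual A B 1).2 = B ⊓ (Submodule.span ℝ {p.2})ᗮ := rfl
    have hA1 := finrank_le_finrank_inf_orthogonal_add_one A p.1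
    have hB1 := finrank_le_finrank_inf_orthogonal_add_one B' p.2
    rw [h1, h2]
    refine ih (B' := B' ⊓ (Submodule.span ℝ {p.2})ᗮ) (by omega) (by omega)
      (inf_le_inf_right _ hB) ?_
    rintro Y ⟨hY, hYp⟩
    obtain ⟨X, hX, hXY⟩ := h Y hY
    -- Since `Y` is orthogonal to `p.1` as well, removing from `X` its component along `p.1` brings
    -- `X` into the residual of `A` without increasing its distance to `Y`.
    have hYX : inner ℝ p.1 Y = 0 :=
      hp.inner_eq_zero (hB hY) (Submodule.mem_orthogonal_singleton_iff_inner_right.1 hYp)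
    have hpp : inner ℝ p.1 p.1 = (1 : ℝ) := by rw [real_inner_self_eq_norm_sq, hp.2.2.1]; norm_num
    have hX'o : inner ℝ p.1 (X - inner ℝ p.1 X • p.1) = 0 := by
      rw [inner_sub_right, inner_smul_right, hpp]; ring
    refine ⟨X - inner ℝ p.1 X • p.1, ⟨A.sub_mem hX (A.smul_mem _ hp.1),
      Submodule.mem_orthogonal_singleton_iff_inner_right.2 hX'o⟩, le_trans ?_ hXY⟩
    set X' := X - inner ℝ p.1 X • p.1 with hX'
    have h5 : Y - X = (Y - X') - inner ℝ p.1 X • p.1 := by rw [hX']; abel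
    have h6 : inner ℝ (Y - X') (inner ℝ p.1 X • p.1) = 0 := by
      rw [inner_smul_right, real_inner_comm p.1 (Y - X'), inner_sub_right, hX'o, hYX]; ring
    have h7 := norm_sub_sq_real (Y - X') (inner ℝ p.1 X • p.1)
    rw [← h5, h6] at h7
    refine (sq_le_sq₀ (norm_nonneg _) (norm_nonneg _)).1 ?_
    nlinarith [sq_nonneg ‖inner ℝ p.1 X • p.1‖]

/-! ### Vanishing of canonical angles -/

theorem mem_inf_of_sinAngle_eq_zero {A B : Submodule ℝ (E n)} {X Y : E n} (hX : X ∈ A) (hY : Y ∈ B)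
    (hY0 : Y ≠ 0) (h : sinAngle X Y = 0) : X ∈ A ⊓ B := by
  refine ⟨hX, ?_⟩
  rcases InnerProductGeometry.sin_eq_zero_iff_angle_eq_zero_or_angle_eq_pi.1 h with h | h
  · obtain ⟨-, r, hr, rfl⟩ := InnerProductGeometry.angle_eq_zero_iff.1 h
    simpa [hr.ne'] using B.smul_mem r⁻¹ hY
  · obtain ⟨-, r, hr, rfl⟩ := InnerProductGeometry.angle_eq_pi_iff.1 h
    simpa [hr.ne] using B.smul_mem r⁻¹ hY

/-- If the `j`-th canonical angle vanishes, then so do the previous ones, and the subspaces meet in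
dimension at least `j`. -/
theorem le_finrank_inf_of_psi_eq_zero {j : ℕ} (hj : 1 ≤ j) {A B : Submodule ℝ (E n)}
    (hA : j ≤ Module.finrank ℝ A) (hB : j ≤ Module.finrank ℝ B) (h : psi A B j = 0) :
    minSine A B = 0 ∧ j ≤ Module.finrank ℝ (A ⊓ B : Submodule ℝ (E n)) := by
  induction j, hj using Nat.le_induction generalizing A B with
  | base =>
    refine ⟨h, ?_⟩
    obtain ⟨p, h1, h2, h3, h4, h5⟩ := exists_isMinimizingPair A B (ne_bot_of_one_le_finrank hA)
      (ne_bot_of_one_le_finrank hB)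
    have hX0 : p.1 ≠ 0 := by intro h; simp [h] at h3
    rw [Submodule.one_le_finrank_iff]
    intro hbot
    have := mem_inf_of_sinAngle_eq_zero h1 h2 (by intro h; simp [h] at h4) (h5.trans h)
    rw [hbot] at this
    exact hX0 (by simpa using this)
  | succ j hj ih =>
    have hp : IsMinimizingPair A B (minimizingPair A B) :=
      isMinimizingPair_minimizingPair (ne_bot_of_one_le_finrank (by omega))
        (ne_bot_of_one_le_finrank (by omega))
    obtain ⟨i, rfl⟩ := Nat.exists_eq_add_of_le' hj
    rw [psi_succ_succ] at h
    set p := minimizingPair A B with hpdef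
    have hA1 := finrank_le_finrank_inf_orthogonal_add_one A p.1
    have hB1 := finrank_le_finrank_inf_orthogonal_add_one B p.2
    obtain ⟨h3, h4⟩ := ih (A := A ⊓ (Submodule.span ℝ {p.1})ᗮ)
      (B := B ⊓ (Submodule.span ℝ {p.2})ᗮ) (by omega) (by omega) h
    have h5 : minSine A B = 0 := by
      refine le_antisymm ?_ (minSine_nonneg _ _)
      rw [← h3]
      exact minSine_mono inf_le_left inf_le_left (ne_bot_of_one_le_finrank (by omega))
        (ne_bot_of_one_le_finrank (by omega))
    refine ⟨h5, ?_⟩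
    have hX0 : p.1 ≠ 0 := by intro h; simpa [h] using hp.2.2.1
    have hmem := mem_inf_of_sinAngle_eq_zero hp.1 hp.2.1
      (by intro h; simpa [h] using hp.2.2.2.1) (hp.2.2.2.2.trans h5)
    -- The inclusion is strict because `p.1` lies in `A ⊓ B` but is not orthogonal to itself; this
    -- gains the missing dimension.
    have hlt : (A ⊓ (Submodule.span ℝ {p.1})ᗮ ⊓ (B ⊓ (Submodule.span ℝ {p.2})ᗮ) :
        Submodule ℝ (E n)) < A ⊓ B := by
      refine lt_of_le_of_ne (inf_le_inf inf_le_left inf_le_left) fun heq => ?_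
      rw [← heq] at hmem
      have := Submodule.mem_orthogonal_singleton_iff_inner_right.1 hmem.1.2
      exact hX0 (inner_self_eq_zero.1 this)
    have := Submodule.finrank_lt_finrank_of_lt hlt
    omega

theorem psi_pos_of_mem_irrationalSubspaces {d e j : ℕ} (hj : 1 ≤ j) (hjd : j ≤ d) (hje : j ≤ e)
    {A B : Submodule ℝ (E n)} (hA : A ∈ irrationalSubspaces n d e j)
    (hB : B ∈ rationalSubspaces n e) : 0 < psi A B j := by
  refine lt_of_le_of_ne (psi_nonneg A B j) fun h => ?_
  have h1 := (le_finrank_inf_of_psi_eq_zero hj (hjd.trans hA.1.ge) (hje.trans hB.2.ge) h.symm).2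
  exact absurd (hA.2 B hB) (by omega)

end

section

variable {n e : ℕ}

/-! ### Minors and echelon bases -/

/-- The minor of the matrix with columns `v` on the rows `g`. -/
def minor (v : Fin e → E n) (g : Fin e → Fin n) : ℝ :=
  Matrix.det (Matrix.of fun r c : Fin e => v c (g r))

theorem minor_eq_mul_det {v w : Fin e → E n} {G : Matrix (Fin e) (Fin e) ℝ}
    (h : ∀ c, w c = ∑ k, G k c • v k) (g : Fin e → Fin n) : minor w g = minor v g * G.det := by
  unfold minor
  rw [← Matrix.det_mul]
  congr 1
  ext r c
  simp [h, Matrix.mul_apply, mul_comm]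

/-- Row rank equals column rank, so `e` independent vectors have `e` independent coordinate rows. -/
theorem exists_minor_ne_zero {v : Fin e → E n} (hv : LinearIndependent ℝ v) :
    ∃ g, minor v g ≠ 0 := by
  let N : Matrix (Fin e) (Fin n) ℝ := Matrix.of fun c i => v c i
  have hN : LinearIndependent ℝ N.row :=
    hv.map' (WithLp.linearEquiv 2 ℝ (Fin n → ℝ)).toLinearMap (LinearEquiv.ker _)
  have hr : N.rank = e := by simpa using hN.rank_matrix
  rw [Matrix.rank_eq_finrank_span_cols] at hr
  obtain ⟨f, hf, -, hfi⟩ := Submodule.exists_fun_fin_finrank_span_eq ℝ (Set.range N.col)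
  choose g hg using hf
  have hcast : Function.Injective (Fin.cast hr.symm : Fin e → _) := Fin.cast_injective _
  refine ⟨g ∘ Fin.cast hr.symm, fun h0 => ?_⟩
  have h1 : (Matrix.of fun r c : Fin e => v c ((g ∘ Fin.cast hr.symm) r)).row
      = f ∘ Fin.cast hr.symm := by
    ext r c
    simp [← hg, N]
  have h2 : LinearIndependent ℝ
      (Matrix.of fun r c : Fin e => v c ((g ∘ Fin.cast hr.symm) r)).row := by
    rw [h1]
    exact hfi.comp _ hcast
  rw [Matrix.linearIndependent_rows_iff_isUnit, Matrix.isUnit_iff_isUnit_det] at h2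
  exact h2.ne_zero h0

/-- Sorting the rows permutes them, which changes the minor at most by a sign. -/
theorem exists_pluckerIndex_abs_eq (v : Fin e → E n) {g : Fin e → Fin n}
    (hg : Function.Injective g) : ∃ I, |pluckerCoords v I| = |minor v g| := by
  let s : Finset (Fin n) := Finset.univ.image g
  have hs : s.card = e := by simp [s, Finset.card_image_of_injective _ hg]
  have h1 : ∀ r, ∃ k, g k = s.orderEmbOfFin hs r := by
    intro r
    obtain ⟨k, -, hk⟩ := Finset.mem_image.1 (s.orderEmbOfFin_mem hs r)
    exact ⟨k, hk⟩
  choose σ hσ using h1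
  have hσi : Function.Injective σ := by
    intro a b hab
    have : g (σ a) = g (σ b) := by rw [hab]
    rw [hσ, hσ] at this
    exact (s.orderEmbOfFin hs).injective this
  let τ : Equiv.Perm (Fin e) := Equiv.ofBijective σ (Finite.injective_iff_bijective.1 hσi)
  refine ⟨⟨s, hs⟩, ?_⟩
  have h2 : pluckerCoords v ⟨s, hs⟩
      = Matrix.det ((Matrix.of fun r c : Fin e => v c (g r)).submatrix τ id) := by
    unfold pluckerCoords
    congr 1
    ext r c
    simp [τ, hσ]
  rw [h2, Matrix.det_permute, abs_mul]
  rcases Int.units_eq_one_or (Equiv.Perm.sign τ) with h | h <;> simp [h, minor]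

theorem minor_ne_zero_injective {v : Fin e → E n} {g : Fin e → Fin n} (h : minor v g ≠ 0) :
    Function.Injective g := by
  intro a b hab
  by_contra hne
  refine h (Matrix.det_zero_of_row_eq hne ?_)
  ext c
  simp [hab]

theorem exists_pluckerCoords_ne_zero {v : Fin e → E n} (hv : LinearIndependent ℝ v) :
    ∃ I, pluckerCoords v I ≠ 0 := by
  obtain ⟨g, hg⟩ := exists_minor_ne_zero hv
  obtain ⟨I, hI⟩ := exists_pluckerIndex_abs_eq v (minor_ne_zero_injective hg)
  exact ⟨I, by rw [← abs_pos, hI, abs_pos]; exact hg⟩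

/-- The scalar is the determinant of the change of basis; it is nonzero because some Plücker
coordinate of `w` is. -/
theorem exists_pluckerCoords_eq_mul {v w : Fin e → E n} (hw : LinearIndependent ℝ w)
    (h : Submodule.span ℝ (Set.range w) ≤ Submodule.span ℝ (Set.range v)) :
    ∃ t : ℝ, t ≠ 0 ∧ ∀ I, pluckerCoords w I = t * pluckerCoords v I := by
  have h1 : ∀ c, ∃ a : Fin e → ℝ, ∑ k, a k • v k = w c := fun c =>
    (Submodule.mem_span_range_iff_exists_fun ℝ).1 (h (Submodule.subset_span ⟨c, rfl⟩))
  choose a ha using h1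
  have h2 : ∀ I, pluckerCoords w I = Matrix.det (Matrix.of fun k c => a c k) * pluckerCoords v I :=
    fun I => by
      rw [mul_comm]
      exact minor_eq_mul_det (fun c => (ha c).symm) _
  refine ⟨_, ?_, h2⟩
  intro h0
  obtain ⟨I, hI⟩ := exists_pluckerCoords_ne_zero hw
  exact hI (by rw [h2, h0, zero_mul])

/-- The vectors `b` are in echelon form on the rows `g`. -/
def IsEchelon (b : Fin e → E n) (g : Fin e → Fin n) : Prop :=
  ∀ c r, b c (g r) = if r = c then 1 else 0

theorem IsEchelon.sum_apply {b : Fin e → E n} {g : Fin e → Fin n} (h : IsEchelon b g)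
    (a : Fin e → ℝ) (r : Fin e) : (∑ k, a k • b k) (g r) = a r := by
  simp [h _ r]

theorem IsEchelon.linearIndependent {b : Fin e → E n} {g : Fin e → Fin n} (h : IsEchelon b g) :
    LinearIndependent ℝ b := by
  rw [Fintype.linearIndependent_iff]
  intro a ha r
  rw [← h.sum_apply a r, ha]
  rfl

theorem IsEchelon.injective {b : Fin e → E n} {g : Fin e → Fin n} (h : IsEchelon b g) :
    Function.Injective g := by
  intro r s hrs
  by_contra hne
  have h1 := h s r
  rw [hrs, h, if_pos rfl, if_neg hne] at h1
  exact one_ne_zero h1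

theorem IsEchelon.minor_self {b : Fin e → E n} {g : Fin e → Fin n} (h : IsEchelon b g) :
    minor b g = 1 := by
  unfold minor
  rw [← Matrix.det_one (n := Fin e) (R := ℝ)]
  congr 1
  ext r c
  simp [h c r, Matrix.one_apply]

/-- Each entry is thus itself a minor, so a bound on the minors bounds the entries. -/
theorem IsEchelon.minor_update {b : Fin e → E n} {g : Fin e → Fin n} (h : IsEchelon b g)
    (c : Fin e) (i : Fin n) : minor b (Function.update g c i) = b c i := by
  have h1 : (Matrix.of fun r k : Fin e => b k (Function.update g c i r))
      = (1 : Matrix (Fin e) (Fin e) ℝ).updateRow c (fun k => b k i) := by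
    ext r k
    rcases eq_or_ne r c with rfl | hr
    · simp
    · simp [hr, h k r, Matrix.one_apply]
  unfold minor
  rw [h1, ← Matrix.cramer_transpose_apply]
  simp

/-- Every subspace has an echelon basis all of whose minors are bounded by `1`. -/
theorem exists_isEchelon {v : Fin e → E n} (hv : LinearIndependent ℝ v) :
    ∃ (b : Fin e → E n) (g : Fin e → Fin n), IsEchelon b g ∧
      Submodule.span ℝ (Set.range b) = Submodule.span ℝ (Set.range v) ∧
      (∀ g', |minor b g'| ≤ 1) := by
  obtain ⟨g₀, hg₀⟩ := exists_minor_ne_zero hv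
  have : Nonempty (Fin e → Fin n) := ⟨g₀⟩
  -- Normalizing by the block of largest minor divides all minors by the largest one.
  obtain ⟨g, hg⟩ := Finite.exists_max (fun g => |minor v g|)
  have hpos : 0 < |minor v g| := (abs_pos.2 hg₀).trans_le (hg g₀)
  have hne : minor v g ≠ 0 := abs_pos.1 hpos
  let M : Matrix (Fin e) (Fin e) ℝ := Matrix.of fun r c => v c (g r)
  have hM : IsUnit M.det := isUnit_iff_ne_zero.2 hne
  let b : Fin e → E n := fun c => ∑ k, M⁻¹ k c • v k
  have hb : IsEchelon b g := by
    intro c r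
    have h1 : (M * M⁻¹) r c = if r = c then 1 else 0 := by
      rw [Matrix.mul_nonsing_inv _ hM, Matrix.one_apply]
    rw [← h1, Matrix.mul_apply]
    simp [b, M, mul_comm]
  refine ⟨b, g, hb, ?_, ?_⟩
  · refine Submodule.eq_of_le_of_finrank_eq (Submodule.span_le.2 ?_) ?_
    · rintro _ ⟨c, rfl⟩
      exact Submodule.sum_mem _ fun k _ => Submodule.smul_mem _ _ (Submodule.subset_span ⟨k, rfl⟩)
    · rw [finrank_span_eq_card hb.linearIndependent, finrank_span_eq_card hv]
  · intro g'
    have h1 : minor b g' = minor v g' * M⁻¹.det := minor_eq_mul_det (fun c => rfl) g'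
    have h2 : M⁻¹.det = (minor v g)⁻¹ := by
      rw [Matrix.det_nonsing_inv, Ring.inverse_eq_inv']
      rfl
    rw [h1, h2, abs_mul, abs_inv, ← div_eq_mul_inv, div_le_one hpos]
    exact hg g'

end

section

variable {n e : ℕ}

/-! ### Heights -/

/-- Guarantees that the choice made in `height` is a genuine primitive representative. -/
theorem exists_isPrimitivePlucker {v : Fin e → E n} (hv : LinearIndependent ℝ v) {s : ℝ}
    (hs : s ≠ 0) {η : PluckerIndex n e → ℤ} (hη : ∀ I, (η I : ℝ) = s * pluckerCoords v I) :
    ∃ ξ : PluckerIndex n e → ℤ, IsPrimitivePlucker (Submodule.span ℝ (Set.range v)) ξ := by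
  obtain ⟨I₀, hI₀⟩ := exists_pluckerCoords_ne_zero hv
  have hη0 : η I₀ ≠ 0 := by
    have : (η I₀ : ℝ) ≠ 0 := by rw [hη]; exact mul_ne_zero hs hI₀
    exact_mod_cast this
  have hg : Finset.univ.gcd η ≠ 0 := fun h =>
    hη0 (Finset.gcd_eq_zero_iff.1 h I₀ (Finset.mem_univ _))
  obtain ⟨ξ, hξ, hξ1⟩ := Finset.extract_gcd η (s := Finset.univ) ⟨I₀, Finset.mem_univ _⟩
  have hg' : ((Finset.univ.gcd η : ℤ) : ℝ) ≠ 0 := by exact_mod_cast hg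
  refine ⟨ξ, hξ1, v, hv, rfl, s / (Finset.univ.gcd η : ℤ), div_ne_zero hs hg', fun I => ?_⟩
  have h1 := hη I
  rw [hξ I (Finset.mem_univ _)] at h1
  push_cast at h1
  rw [div_mul_eq_mul_div, ← h1]
  field_simp

theorem IsPrimitivePlucker.exists_ne_zero {B : Submodule ℝ (E n)} {ξ : PluckerIndex n e → ℤ}
    (h : IsPrimitivePlucker B ξ) : ∃ I, ξ I ≠ 0 := by
  by_contra! h0
  have : Finset.univ.gcd ξ = 0 := Finset.gcd_eq_zero_iff.2 fun I _ => h0 I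
  rw [h.1] at this
  exact one_ne_zero this

/-- An integral multiple of the Plücker coordinates bounds the height. -/
theorem height_le_of_integral {v : Fin e → E n} (hv : LinearIndependent ℝ v) {s : ℝ}
    (hs : s ≠ 0) {η : PluckerIndex n e → ℤ} (hη : ∀ I, (η I : ℝ) = s * pluckerCoords v I) :
    height e (Submodule.span ℝ (Set.range v)) ≤ √(∑ I, (η I : ℝ) ^ 2) := by
  have hex := exists_isPrimitivePlucker hv hs hη
  unfold height
  set ξ := Classical.epsilon fun ξ : PluckerIndex n e → ℤ =>
    IsPrimitivePlucker (Submodule.span ℝ (Set.range v)) ξ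
  have hξ : IsPrimitivePlucker (Submodule.span ℝ (Set.range v)) ξ := Classical.epsilon_spec hex
  obtain ⟨I₀, hI₀⟩ := hξ.exists_ne_zero
  obtain ⟨hgcd, w, hw, hspan, c, hc, hcw⟩ := hξ
  obtain ⟨t, ht, htw⟩ := exists_pluckerCoords_eq_mul hw hspan.le
  have hu : ∀ I, (η I : ℝ) = s / (c * t) * ξ I := by
    intro I
    rw [hη, hcw, htw]
    field_simp
  have hu0 : s / (c * t) ≠ 0 := by positivity
  set u := s / (c * t)
  -- Taking gcds over `I` in this identity, with `ξ` primitive, shows that `ξ I₀` divides `η I₀`;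
  -- hence the ratio `u` has absolute value at least 1.
  have hcross : ∀ I, ξ I₀ * η I = η I₀ * ξ I := by
    intro I
    have : (ξ I₀ : ℝ) * η I = η I₀ * ξ I := by rw [hu, hu]; ring
    exact_mod_cast this
  have hη0 : η I₀ ≠ 0 := by
    have : (η I₀ : ℝ) ≠ 0 := by
      rw [hu]
      exact mul_ne_zero hu0 (by exact_mod_cast hI₀)
    exact_mod_cast this
  have hgη : Finset.univ.gcd η ≠ 0 := fun h =>
    hη0 (Finset.gcd_eq_zero_iff.1 h I₀ (Finset.mem_univ _))
  have h1 : normalize (ξ I₀) * Finset.univ.gcd η = normalize (η I₀) := by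
    rw [← Finset.gcd_mul_left, funext hcross, Finset.gcd_mul_left, hgcd, mul_one]
  have h2 : |ξ I₀| ≤ |η I₀| := by
    have h3 := congrArg abs h1
    rw [← Int.abs_eq_normalize, ← Int.abs_eq_normalize, abs_mul, abs_abs, abs_abs] at h3
    rw [← h3]
    exact le_mul_of_one_le_right (abs_nonneg _) (Int.one_le_abs hgη)
  have hu1 : 1 ≤ |u| := by
    have h4 : (|ξ I₀| : ℝ) ≤ |(η I₀ : ℝ)| := by exact_mod_cast h2
    rw [hu, abs_mul] at h4
    have h5 : 0 < |(ξ I₀ : ℝ)| := abs_pos.2 (by exact_mod_cast hI₀)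
    exact le_of_mul_le_mul_right (by simpa using h4) h5
  refine Real.sqrt_le_sqrt (Finset.sum_le_sum fun I _ => ?_)
  rw [hu, ← sq_abs (u * (ξ I : ℝ)), ← sq_abs (ξ I : ℝ), abs_mul]
  exact pow_le_pow_left₀ (abs_nonneg _) (le_mul_of_one_le_left (abs_nonneg _) hu1) 2

theorem sqrt_sum_sq_le {ι : Type*} [Fintype ι] {x : ι → ℝ} {K : ℝ} (hK : 0 ≤ K)
    (h : ∀ i, |x i| ≤ K) : √(∑ i, x i ^ 2) ≤ Fintype.card ι * K := by
  refine Real.sqrt_le_iff.2 ⟨by positivity, ?_⟩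
  have h1 : ∑ i, x i ^ 2 ≤ Fintype.card ι * K ^ 2 := by
    rw [← nsmul_eq_mul, ← Finset.card_univ, ← Finset.sum_const]
    refine Finset.sum_le_sum fun i _ => ?_
    rw [← sq_abs]
    exact pow_le_pow_left₀ (abs_nonneg _) (h i) 2
  refine h1.trans ?_
  rw [mul_pow]
  gcongr
  have : Fintype.card ι ≤ Fintype.card ι ^ 2 := Nat.le_self_pow two_ne_zero _
  exact_mod_cast this

theorem height_le_of_integral_of_abs_le {v : Fin e → E n} (hv : LinearIndependent ℝ v) {s : ℝ}
    (hs : s ≠ 0) (hint : ∀ I, ∃ m : ℤ, (m : ℝ) = s * pluckerCoords v I) {K : ℝ} (hK : 0 ≤ K)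
    (h : ∀ I, |s * pluckerCoords v I| ≤ K) :
    height e (Submodule.span ℝ (Set.range v)) ≤ Fintype.card (PluckerIndex n e) * K := by
  choose η hη using hint
  refine (height_le_of_integral hv hs hη).trans (sqrt_sum_sq_le hK fun I => ?_)
  rw [hη]
  exact h I

/-- A vector of `ℤⁿ`, seen in `ℝⁿ`. -/
def intVec (z : Fin n → ℤ) : E n := WithLp.toLp 2 (fun k => (z k : ℝ))

@[simp]
theorem intVec_apply (z : Fin n → ℤ) (k : Fin n) : intVec z k = z k := rfl

theorem exists_intVec_of_mem_rationalSubspaces {B : Submodule ℝ (E n)}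
    (hB : B ∈ rationalSubspaces n e) : ∃ w : Fin e → Fin n → ℤ,
      LinearIndependent ℝ (fun i => intVec (w i)) ∧
        Submodule.span ℝ (Set.range fun i => intVec (w i)) = B := by
  obtain ⟨⟨m, v, hv, hspan⟩, hdim⟩ := hB
  obtain rfl : m = e := by
    rw [← hdim, ← hspan, finrank_span_eq_card hv, Fintype.card_fin]
  obtain ⟨D, hD⟩ := IsLocalization.exist_integer_multiples_of_finite (nonZeroDivisors ℤ)
    (fun p : Fin m × Fin n => v p.1 p.2)
  choose w hw using fun i k => hD (i, k)
  have hD0 : ((D : ℤ) : ℝ) ≠ 0 := by exact_mod_cast nonZeroDivisors.coe_ne_zero D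
  have h1 : ∀ i, intVec (w i) = ((D : ℤ) : ℝ) • ratVec (v i) := by
    intro i
    ext k
    have h2 : ((w i k : ℤ) : ℚ) = (D : ℤ) * v i k := by
      have := hw i k
      simpa [Submonoid.smul_def] using this
    have h3 : ((w i k : ℤ) : ℝ) = (D : ℤ) * (v i k : ℝ) := by exact_mod_cast h2
    simpa [intVec, ratVec] using h3
  have hli : LinearIndependent ℝ (fun i => intVec (w i)) := by
    have h4 := hv.units_smul (fun _ => Units.mk0 _ hD0)
    convert h4 using 1
    ext1 i
    rw [h1]
    rfl
  refine ⟨w, hli, ?_⟩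
  rw [← hspan]
  refine Submodule.eq_of_le_of_finrank_eq (Submodule.span_le.2 ?_) ?_
  · rintro _ ⟨i, rfl⟩
    simp only [h1]
    exact Submodule.smul_mem _ _ (Submodule.subset_span ⟨i, rfl⟩)
  · rw [finrank_span_eq_card hli, finrank_span_eq_card hv]

theorem pluckerCoords_intVec (w : Fin e → Fin n → ℤ) (I : PluckerIndex n e) :
    ((Matrix.det (Matrix.of fun r c : Fin e => w c (I.1.orderEmbOfFin I.2 r)) : ℤ) : ℝ)
      = pluckerCoords (fun i => intVec (w i)) I := by
  exact RingHom.map_det (Int.castRingHom ℝ) _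

theorem span_intVec_mem_rationalSubspaces {w : Fin e → Fin n → ℤ}
    (hw : LinearIndependent ℝ fun i => intVec (w i)) :
    Submodule.span ℝ (Set.range fun i => intVec (w i)) ∈ rationalSubspaces n e := by
  have h : ∀ i, intVec (w i) = ratVec (fun k => (w i k : ℚ)) := by
    intro i
    ext k
    simp [ratVec]
  refine ⟨⟨e, fun i k => (w i k : ℚ), ?_, ?_⟩, ?_⟩
  · simpa only [← h] using hw
  · simp only [← h]
  · rw [finrank_span_eq_card hw, Fintype.card_fin]

theorem exists_isPrimitivePlucker_height {B : Submodule ℝ (E n)}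
    (hB : B ∈ rationalSubspaces n e) : ∃ ξ : PluckerIndex n e → ℤ, IsPrimitivePlucker B ξ ∧
      height e B = √(∑ I, (ξ I : ℝ) ^ 2) := by
  obtain ⟨w, hw, rfl⟩ := exists_intVec_of_mem_rationalSubspaces hB
  exact ⟨_, Classical.epsilon_spec (exists_isPrimitivePlucker hw one_ne_zero
    fun I => by rw [one_mul]; exact pluckerCoords_intVec w I), rfl⟩

theorem abs_le_sqrt_sum_sq {ι : Type*} [Fintype ι] (x : ι → ℝ) (i : ι) :
    |x i| ≤ √(∑ i, x i ^ 2) := by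
  refine Real.abs_le_sqrt ?_
  exact Finset.single_le_sum (f := fun i => x i ^ 2) (fun i _ => sq_nonneg _) (Finset.mem_univ i)

theorem one_le_height {B : Submodule ℝ (E n)} (hB : B ∈ rationalSubspaces n e) :
    1 ≤ height e B := by
  obtain ⟨ξ, hξ, h⟩ := exists_isPrimitivePlucker_height hB
  obtain ⟨I, hI⟩ := hξ.exists_ne_zero
  rw [h]
  refine le_trans ?_ (abs_le_sqrt_sum_sq (fun I => (ξ I : ℝ)) I)
  have := Int.one_le_abs hI
  exact_mod_cast this

end

section

variable {n f : ℕ}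

/-! ### Rational subspaces containing a given one -/

/-- The pigeonhole principle modulo `ℤ`. -/
theorem exists_ne_forall_abs_sub_sub_le {α ι : Type*} [Fintype α] [Fintype ι] (p : α → ι → ℝ)
    {T : ℕ} (hT : 1 ≤ T) (h : T ^ Fintype.card ι < Fintype.card α) :
    ∃ x y, x ≠ y ∧ ∃ z : ι → ℤ, ∀ i, |p x i - p y i - z i| ≤ 1 / T := by
  classical
  have hT0 : (0 : ℝ) < T := by exact_mod_cast hT
  have hlt : ∀ x i, ⌊T * Int.fract (p x i)⌋₊ < T := by
    intro x i
    rw [Nat.floor_lt (mul_nonneg hT0.le (Int.fract_nonneg _))]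
    exact mul_lt_of_lt_one_right hT0 (Int.fract_lt_one _)
  let F : α → ι → Fin T := fun x i => ⟨⌊T * Int.fract (p x i)⌋₊, hlt x i⟩
  obtain ⟨x, y, hxy, hF⟩ := Fintype.exists_ne_map_eq_of_card_lt F (by simpa using h)
  refine ⟨x, y, hxy, fun i => ⌊p x i⌋ - ⌊p y i⌋, fun i => ?_⟩
  have h1 : ⌊T * Int.fract (p x i)⌋₊ = ⌊T * Int.fract (p y i)⌋₊ :=
    congrArg Fin.val (congrFun hF i)
  have hx1 := Nat.floor_le (mul_nonneg hT0.le (Int.fract_nonneg (p x i)))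
  have hx2 := Nat.lt_floor_add_one (T * Int.fract (p x i))
  have hy1 := Nat.floor_le (mul_nonneg hT0.le (Int.fract_nonneg (p y i)))
  have hy2 := Nat.lt_floor_add_one (T * Int.fract (p y i))
  rw [h1] at hx1 hx2
  have h2 : p x i - p y i - ((⌊p x i⌋ - ⌊p y i⌋ : ℤ) : ℝ)
      = Int.fract (p x i) - Int.fract (p y i) := by
    rw [← Int.self_sub_floor, ← Int.self_sub_floor]
    push_cast
    ring
  have h3 (a : ℝ) : |a| * T = |a * T| := by rw [abs_mul, abs_of_pos hT0]
  rw [h2, le_div_iff₀ hT0, h3, abs_le]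
  constructor <;> nlinarith

/-- The integral coefficients of the integral linear combinations of `b` which are integral
vectors. -/
def integralCoeffs (b : Fin f → E n) : Submodule ℤ (Fin f → ℤ) where
  carrier := {x | ∃ z : Fin n → ℤ, ∑ k, (x k : ℝ) • b k = intVec z}
  zero_mem' := ⟨0, by ext; simp⟩
  add_mem' := by
    rintro x y ⟨z, hz⟩ ⟨t, ht⟩
    refine ⟨z + t, ?_⟩
    have : ∑ k, (((x + y) k : ℤ) : ℝ) • b k = intVec z + intVec t := by
      rw [← hz, ← ht, ← Finset.sum_add_distrib]
      simp [add_smul]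
    rw [this]
    ext
    simp
  smul_mem' := by
    rintro a x ⟨z, hz⟩
    refine ⟨a • z, ?_⟩
    have : ∑ k, (((a • x) k : ℤ) : ℝ) • b k = (a : ℝ) • intVec z := by
      rw [← hz, Finset.smul_sum]
      simp [mul_smul]
    rw [this]
    ext
    simp

theorem IsEchelon.eq_sum_of_mem_span {b : Fin f → E n} {g : Fin f → Fin n} (h : IsEchelon b g)
    {Y : E n} (hY : Y ∈ Submodule.span ℝ (Set.range b)) : ∑ k, Y (g k) • b k = Y := by
  obtain ⟨a, rfl⟩ := (Submodule.mem_span_range_iff_exists_fun ℝ).1 hY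
  simp only [h.sum_apply]

/-- An integral vector of the span has its pivot coordinates as coefficients, so `integralCoeffs b`
is the image of the integral points. An integral basis of the span supplies `f` independent
elements. -/
theorem finrank_integralCoeffs {b : Fin f → E n} {g : Fin f → Fin n} (h : IsEchelon b g)
    (hB : Submodule.span ℝ (Set.range b) ∈ rationalSubspaces n f) :
    Module.finrank ℤ (integralCoeffs b) = f := by
  obtain ⟨w, hw, hspan⟩ := exists_intVec_of_mem_rationalSubspaces hB
  have h1 : ∀ l, ∑ k, (w l (g k) : ℝ) • b k = intVec (w l) := fun l =>
    h.eq_sum_of_mem_span (by rw [← hspan]; exact Submodule.subset_span ⟨l, rfl⟩)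
  let x : Fin f → integralCoeffs b := fun l => ⟨fun k => w l (g k), w l, h1 l⟩
  let G : Matrix (Fin f) (Fin f) ℤ := Matrix.of fun l k => w l (g k)
  have hG : G.det ≠ 0 := by
    obtain ⟨I, hI⟩ := exists_pluckerCoords_ne_zero hw
    intro h0
    have h2 := minor_eq_mul_det (v := b) (w := fun l => intVec (w l))
      (G := (G.map (Int.castRingHom ℝ)).transpose) (fun c => (h1 c).symm) (I.1.orderEmbOfFin I.2)
    rw [Matrix.det_transpose, ← RingHom.mapMatrix_apply, ← RingHom.map_det, h0, map_zero,
      mul_zero] at h2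
    exact hI h2
  have hx : LinearIndependent ℤ x :=
    LinearIndependent.of_comp (integralCoeffs b).subtype
      (Matrix.linearIndependent_rows_of_det_ne_zero hG)
  refine le_antisymm ?_ ?_
  · simpa using Submodule.finrank_le (integralCoeffs b)
  · simpa using hx.fintype_card_le_finrank

theorem finite_quotient_integralCoeffs {b : Fin f → E n} {g : Fin f → Fin n} (h : IsEchelon b g)
    (hB : Submodule.span ℝ (Set.range b) ∈ rationalSubspaces n f) :
    Finite ((Fin f → ℤ) ⧸ integralCoeffs b) :=
  (Submodule.finiteQuotient_iff _).2 (by simpa using finrank_integralCoeffs h hB)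

/-- The height is controlled by the number of classes of integral coefficients. -/
theorem height_le_mul_card_quotient {b : Fin f → E n} {g : Fin f → Fin n} (h : IsEchelon b g)
    (hb : ∀ g', |minor b g'| ≤ 1)
    (hB : Submodule.span ℝ (Set.range b) ∈ rationalSubspaces n f) :
    height f (Submodule.span ℝ (Set.range b))
      ≤ Fintype.card (PluckerIndex n f) * Nat.card ((Fin f → ℤ) ⧸ integralCoeffs b) := by
  have := finite_quotient_integralCoeffs h hB
  let β := Module.finBasisOfFinrankEq ℤ (integralCoeffs b) (finrank_integralCoeffs h hB)
  let G : Matrix (Fin f) (Fin f) ℤ := Matrix.of fun l k => (β l : Fin f → ℤ) k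
  -- The index is the determinant of a lattice basis. The corresponding integral vectors have
  -- Plücker coordinates `G.det` times those of `b`, hence bounded by the index.
  have hG : G.det.natAbs = Nat.card ((Fin f → ℤ) ⧸ integralCoeffs b) := by
    rw [← Submodule.natAbs_det_basis_change (Pi.basisFun ℤ (Fin f)) _ β, Pi.basisFun_det]
    rfl
  have hG' : |(G.det : ℝ)| = Nat.card ((Fin f → ℤ) ⧸ integralCoeffs b) := by
    rw [← hG, Nat.cast_natAbs, Int.cast_abs]
  have hG0 : (G.det : ℝ) ≠ 0 := by
    rw [← abs_pos, hG']
    exact_mod_cast Nat.card_pos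
  choose z hz using fun l => (β l).2
  have hpl : ∀ I, (G.det : ℝ) * pluckerCoords b I
      = pluckerCoords (fun l => intVec (z l)) I := by
    intro I
    have h2 := minor_eq_mul_det (v := b) (w := fun l => intVec (z l))
      (G := (G.map (Int.castRingHom ℝ)).transpose) (fun c => (hz c).symm) (I.1.orderEmbOfFin I.2)
    rw [Matrix.det_transpose, ← RingHom.mapMatrix_apply, ← RingHom.map_det] at h2
    rw [mul_comm]
    exact h2.symm
  refine height_le_of_integral_of_abs_le h.linearIndependent hG0 (fun I => ?_)
    (Nat.cast_nonneg _) (fun I => ?_)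
  · exact ⟨_, (pluckerCoords_intVec z I).trans (hpl I).symm⟩
  · rw [abs_mul, hG']
    exact mul_le_of_le_one_right (Nat.cast_nonneg _) (hb _)

theorem card_notMem_range {g : Fin f → Fin n} (hg : Function.Injective g) :
    Fintype.card {i // i ∉ Set.range g} = n - f := by
  classical
  rw [Fintype.card_subtype_compl, Fintype.card_fin]
  congr 1
  rw [← Nat.card_eq_fintype_card]
  exact (Nat.card_congr (Equiv.ofInjective g hg).symm).trans (by simp)

/-- An integral vector outside of the span of `b`, but close to it. -/
theorem exists_intVec_notMem_span {b : Fin f → E n} {g : Fin f → Fin n} (h : IsEchelon b g)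
    (hB : Submodule.span ℝ (Set.range b) ∈ rationalSubspaces n f) (hf : f < n) :
    ∃ (x : Fin f → ℤ) (z : Fin n → ℤ), intVec z ∉ Submodule.span ℝ (Set.range b) ∧
      ∀ i, |(intVec z - ∑ k, (x k : ℝ) • b k) i|
        ≤ 2 * (Nat.card ((Fin f → ℤ) ⧸ integralCoeffs b) : ℝ) ^ (-(1 / ((n : ℝ) - f))) := by
  classical
  have := finite_quotient_integralCoeffs h hB
  set N := Nat.card ((Fin f → ℤ) ⧸ integralCoeffs b) with hN
  have hNpos : 0 < N := Nat.card_pos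
  have hm : 0 < (n : ℝ) - f := by
    have : (f : ℝ) < n := by exact_mod_cast hf
    linarith
  rcases (Nat.succ_le_iff.2 hNpos).eq_or_lt with h1 | h1
  · have hex : ∃ i, i ∉ Set.range g := by
      by_contra! hall
      have := Fintype.card_le_of_surjective g hall
      simp only [Fintype.card_fin] at this
      omega
    obtain ⟨i, hi⟩ := hex
    -- When the index is 1 the bound is 2, and a standard basis vector off the pivots suffices.
    refine ⟨0, Pi.single i 1, fun hmem => ?_, fun k => ?_⟩
    · have h3 : ∀ k, intVec (Pi.single i (1 : ℤ)) (g k) = 0 := by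
        intro k
        have : g k ≠ i := fun hk => hi ⟨k, hk⟩
        simp [this]
      have h2 := h.eq_sum_of_mem_span hmem
      rw [Finset.sum_eq_zero (fun k _ => by rw [h3, zero_smul])] at h2
      simpa using congrArg (fun Y : E n => Y i) h2
    · rw [← h1]
      rcases eq_or_ne k i with rfl | hk <;> simp [*]
  · set R : ℝ := (N : ℝ) ^ (1 / ((n : ℝ) - f)) with hR
    have hR1 : 1 < R := Real.one_lt_rpow (by exact_mod_cast h1) (by positivity)
    -- The largest integer strictly below `R`: strictness gives `T ^ (n - f) < N` for the
    -- pigeonhole, and `R ≤ T + 1 ≤ 2 * T` costs only the factor 2.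
    set T : ℕ := ⌈R⌉₊ - 1 with hT
    have hceil : 1 < ⌈R⌉₊ := Nat.lt_ceil.2 (by simpa using hR1)
    have hTR : (T : ℝ) < R := Nat.lt_ceil.1 (by omega)
    have hRT : R ≤ T + 1 := by
      have := Nat.le_ceil R
      have h2 : ((⌈R⌉₊ : ℕ) : ℝ) = T + 1 := by
        rw [hT, Nat.cast_sub hceil.le]; simp
      linarith
    have hT1 : 1 ≤ T := by omega
    have hT1' : (1 : ℝ) ≤ T := by exact_mod_cast hT1
    have hpow : T ^ (n - f) < N := by
      have h2 : (T : ℝ) ^ (n - f) < R ^ (n - f) :=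
        pow_lt_pow_left₀ hTR (by positivity) (by omega)
      have h3 : R ^ (n - f) = N := by
        rw [hR, ← Real.rpow_natCast, ← Real.rpow_mul (Nat.cast_nonneg _), Nat.cast_sub hf.le,
          one_div, inv_mul_cancel₀ hm.ne', Real.rpow_one]
      rw [h3] at h2
      exact_mod_cast h2
    have := Fintype.ofFinite ((Fin f → ℤ) ⧸ integralCoeffs b)
    obtain ⟨q, q', hqq, z, hz⟩ := exists_ne_forall_abs_sub_sub_le
      (fun (q : (Fin f → ℤ) ⧸ integralCoeffs b) (i : {i // i ∉ Set.range g}) =>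
        (∑ k, (q.out k : ℝ) • b k) i.1) hT1
      (by rwa [card_notMem_range h.injective, ← Nat.card_eq_fintype_card])
    let x : Fin f → ℤ := q.out - q'.out
    -- On the pivots `Z` copies `x`. If `Z` lay in the span it would equal `∑ k, x k • b k`, forcing
    -- `x` into `integralCoeffs b`, against `q ≠ q'`.
    let Z : Fin n → ℤ := fun i => if hi : i ∈ Set.range g then x hi.choose else z ⟨i, hi⟩
    have hZg : ∀ k, Z (g k) = x k := by
      intro k
      have hk : g k ∈ Set.range g := ⟨k, rfl⟩
      simp only [Z, dif_pos hk]
      congr 1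
      exact h.injective hk.choose_spec
    have hx : ∑ k, (x k : ℝ) • b k
        = ∑ k, (q.out k : ℝ) • b k - ∑ k, (q'.out k : ℝ) • b k := by
      rw [← Finset.sum_sub_distrib]
      simp [x, sub_smul]
    refine ⟨x, Z, fun hmem => ?_, fun i => ?_⟩
    · have h2 := h.eq_sum_of_mem_span hmem
      simp only [intVec_apply, hZg] at h2
      have h3 : x ∈ integralCoeffs b := ⟨Z, h2⟩
      refine hqq ?_
      rw [← q.out_eq', ← q'.out_eq']
      exact (Submodule.Quotient.eq _).2 h3
    · have hbound : 1 / (T : ℝ) ≤ 2 * (N : ℝ) ^ (-(1 / ((n : ℝ) - f))) := by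
        rw [Real.rpow_neg (Nat.cast_nonneg _), ← hR, div_le_iff₀ (by linarith)]
        field_simp
        linarith
      refine le_trans ?_ hbound
      by_cases hi : i ∈ Set.range g
      · obtain ⟨k, rfl⟩ := hi
        rw [PiLp.sub_apply, h.sum_apply, intVec_apply, hZg]
        simp
      · have h4 := hz ⟨i, hi⟩
        have h5 : Z i = z ⟨i, hi⟩ := by simp only [Z, dif_neg hi]
        rw [PiLp.sub_apply, hx, PiLp.sub_apply, intVec_apply, h5, abs_sub_comm]
        exact h4

end

/-! ### Adjoining a vector and going up -/

section

variable {n f : ℕ}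

/-- The set of indices `J` without its `r`-th element. -/
def eraseIndex (J : PluckerIndex n (f + 1)) (r : Fin (f + 1)) : PluckerIndex n f :=
  ⟨J.1.erase (J.1.orderEmbOfFin J.2 r), by
    rw [Finset.card_erase_of_mem (Finset.orderEmbOfFin_mem _ _ _), J.2, Nat.add_sub_cancel]⟩

theorem orderEmbOfFin_eraseIndex (J : PluckerIndex n (f + 1)) (r : Fin (f + 1)) (k : Fin f) :
    (eraseIndex J r).1.orderEmbOfFin (eraseIndex J r).2 k
      = J.1.orderEmbOfFin J.2 (r.succAbove k) := by
  refine (congrFun (Finset.orderEmbOfFin_unique (eraseIndex J r).2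
    (f := fun k => J.1.orderEmbOfFin J.2 (r.succAbove k)) (fun k => ?_) ?_) k).symm
  · refine Finset.mem_erase.2 ⟨fun h => ?_, Finset.orderEmbOfFin_mem _ _ _⟩
    exact Fin.succAbove_ne r k ((J.1.orderEmbOfFin J.2).injective h)
  · exact (J.1.orderEmbOfFin J.2).strictMono.comp (Fin.strictMono_succAbove r)

/-- The Laplace expansion along the first column. -/
theorem pluckerCoords_cons (Z : E n) (b : Fin f → E n) (J : PluckerIndex n (f + 1)) :
    pluckerCoords (Fin.cons Z b : Fin (f + 1) → E n) J
      = ∑ r : Fin (f + 1), (-1) ^ (r : ℕ) * Z (J.1.orderEmbOfFin J.2 r)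
          * pluckerCoords b (eraseIndex J r) := by
  unfold pluckerCoords
  rw [Matrix.det_succ_column_zero]
  refine Finset.sum_congr rfl fun r _ => ?_
  congr 2
  ext k c
  simp [orderEmbOfFin_eraseIndex]

/-- Column operations preserve minors. Integrality will be read off with `Z` and smallness with `Z -
∑ k, x k • b k`. -/
theorem pluckerCoords_cons_sub_sum (Z : E n) (b : Fin f → E n) (x : Fin f → ℝ)
    (J : PluckerIndex n (f + 1)) :
    pluckerCoords (Fin.cons (Z - ∑ k, x k • b k) b : Fin (f + 1) → E n) J
      = pluckerCoords (Fin.cons Z b : Fin (f + 1) → E n) J := by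
  have h0 : ∀ k, ∑ r : Fin (f + 1), (-1) ^ (r : ℕ) * (b k) (J.1.orderEmbOfFin J.2 r)
      * pluckerCoords b (eraseIndex J r) = 0 := by
    intro k
    rw [← pluckerCoords_cons]
    refine Matrix.det_zero_of_column_eq (Fin.succ_ne_zero k) fun r => ?_
    simp
  rw [pluckerCoords_cons, pluckerCoords_cons]
  have h1 : ∀ r : Fin (f + 1), (-1) ^ (r : ℕ) * (Z - ∑ k, x k • b k) (J.1.orderEmbOfFin J.2 r)
      * pluckerCoords b (eraseIndex J r)
      = (-1) ^ (r : ℕ) * Z (J.1.orderEmbOfFin J.2 r) * pluckerCoords b (eraseIndex J r)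
        - ∑ k, x k * ((-1) ^ (r : ℕ) * (b k) (J.1.orderEmbOfFin J.2 r)
          * pluckerCoords b (eraseIndex J r)) := by
    intro r
    have h2 : (Z - ∑ k, x k • b k) (J.1.orderEmbOfFin J.2 r) = Z (J.1.orderEmbOfFin J.2 r)
        - ∑ k, x k * (b k) (J.1.orderEmbOfFin J.2 r) := by simp
    rw [h2, mul_sub, sub_mul, Finset.mul_sum, Finset.sum_mul]
    congr 1
    exact Finset.sum_congr rfl fun k _ => by ring
  simp only [h1]
  rw [Finset.sum_sub_distrib, Finset.sum_comm]
  simp only [← Finset.mul_sum, h0]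
  simp

theorem exists_isEchelon_of_mem_rationalSubspaces {B : Submodule ℝ (E n)}
    (hB : B ∈ rationalSubspaces n f) : ∃ (b : Fin f → E n) (g : Fin f → Fin n) (s : ℝ),
      IsEchelon b g ∧ Submodule.span ℝ (Set.range b) = B ∧ (∀ g', |minor b g'| ≤ 1) ∧ s ≠ 0 ∧
        |s| ≤ height f B ∧ ∀ I, ∃ m : ℤ, (m : ℝ) = s * pluckerCoords b I := by
  obtain ⟨ξ, ⟨-, v, hv, hspan, c, hc, hcv⟩, hh⟩ := exists_isPrimitivePlucker_height hB
  obtain ⟨b, g, hbg, hbspan, hb⟩ := exists_isEchelon hv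
  obtain ⟨t, ht, htv⟩ := exists_pluckerCoords_eq_mul hv hbspan.ge
  have h1 : ∀ I, (ξ I : ℝ) = c * t * pluckerCoords b I := fun I => by rw [hcv, htv]; ring
  refine ⟨b, g, c * t, hbg, hbspan.trans hspan, hb, mul_ne_zero hc ht, ?_, fun I => ⟨ξ I, h1 I⟩⟩
  obtain ⟨I, hI⟩ := exists_pluckerIndex_abs_eq b hbg.injective
  have h2 := abs_le_sqrt_sum_sq (fun I => (ξ I : ℝ)) I
  rw [hh]
  rwa [h1, abs_mul, hI, hbg.minor_self, abs_one, mul_one] at h2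

/-- A rational subspace is contained in a rational subspace of one more dimension whose height is
controlled. -/
theorem exists_mem_rationalSubspaces_succ (hf : f < n) :
    ∃ c : ℝ, 0 < c ∧ ∀ B ∈ rationalSubspaces n f, ∃ C ∈ rationalSubspaces n (f + 1), B ≤ C ∧
      height (f + 1) C ≤ c * height f B ^ (((n : ℝ) - (f + 1 : ℕ)) / ((n : ℝ) - f)) := by
  set K : ℝ := ((Fintype.card (PluckerIndex n f) : ℕ) : ℝ)
  set K' : ℝ := ((Fintype.card (PluckerIndex n (f + 1)) : ℕ) : ℝ)
  have hm : 0 < (n : ℝ) - f := by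
    have : (f : ℝ) < n := by exact_mod_cast hf
    linarith
  have hK0 : 0 ≤ K := Nat.cast_nonneg _
  have hK'0 : 0 ≤ K' := Nat.cast_nonneg _
  refine ⟨K' * ((f + 1) * (2 * K ^ (1 / ((n : ℝ) - f)))) + 1, by positivity, fun B hB => ?_⟩
  obtain ⟨b, g, s, hbg, rfl, hb, hs, hsH, hint⟩ := exists_isEchelon_of_mem_rationalSubspaces hB
  obtain ⟨x, z, hz, hsmall⟩ := exists_intVec_notMem_span hbg hB hf
  have hHN := height_le_mul_card_quotient hbg hb hB
  have hH1 := one_le_height hB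
  have := finite_quotient_integralCoeffs hbg hB
  have hNpos : 0 < Nat.card ((Fin f → ℤ) ⧸ integralCoeffs b) := Nat.card_pos
  set N := Nat.card ((Fin f → ℤ) ⧸ integralCoeffs b)
  set H := height f (Submodule.span ℝ (Set.range b))
  set Z := intVec z
  have hN0 : (0 : ℝ) < N := by exact_mod_cast hNpos
  have hH0 : 0 < H := by linarith
  set C := Submodule.span ℝ (Set.range (Fin.cons Z b : Fin (f + 1) → E n)) with hC
  have hli : LinearIndependent ℝ (Fin.cons Z b : Fin (f + 1) → E n) :=
    linearIndependent_finCons.2 ⟨hbg.linearIndependent, hz⟩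
  have hCeq : C = Submodule.span ℝ {Z} ⊔ Submodule.span ℝ (Set.range b) := by
    rw [hC, Fin.range_cons, Submodule.span_insert]
  refine ⟨C, ?_, hCeq ▸ le_sup_right, ?_⟩
  · obtain ⟨w, hw, hwspan⟩ := exists_intVec_of_mem_rationalSubspaces hB
    have h1 : (fun i => intVec ((Fin.cons z w : Fin (f + 1) → Fin n → ℤ) i))
        = (Fin.cons Z (fun i => intVec (w i)) : Fin (f + 1) → E n) := by
      funext i
      refine Fin.cases ?_ (fun i => ?_) i <;> simp [Z]
    have h2 := span_intVec_mem_rationalSubspaces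
      (w := (Fin.cons z w : Fin (f + 1) → Fin n → ℤ))
      (by rw [h1]; exact linearIndependent_finCons.2 ⟨hw, by rw [hwspan]; exact hz⟩)
    rwa [h1, Fin.range_cons, Submodule.span_insert, hwspan, ← hCeq] at h2
  · have hpow : (N : ℝ) ^ (-(1 / ((n : ℝ) - f)))
        ≤ K ^ (1 / ((n : ℝ) - f)) * H ^ (-(1 / ((n : ℝ) - f))) := by
      rw [Real.rpow_neg hN0.le, Real.rpow_neg hH0.le, ← div_eq_mul_inv, inv_eq_one_div,
        div_le_div_iff₀ (by positivity) (by positivity), one_mul, ← Real.mul_rpow hK0 hN0.le]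
      exact Real.rpow_le_rpow hH0.le hHN (by positivity)
    have hexp : H * H ^ (-(1 / ((n : ℝ) - f))) = H ^ (((n : ℝ) - (f + 1 : ℕ)) / ((n : ℝ) - f)) := by
      nth_rewrite 1 [← Real.rpow_one H]
      rw [← Real.rpow_add hH0]
      congr 1
      push_cast
      field_simp
      ring
    have hle := height_le_of_integral_of_abs_le hli hs
      (K := (f + 1) * (2 * K ^ (1 / ((n : ℝ) - f)))
        * H ^ (((n : ℝ) - (f + 1 : ℕ)) / ((n : ℝ) - f))) (fun J => ?_) (by positivity) fun J => ?_
    · refine hle.trans ?_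
      rw [← mul_assoc]
      gcongr
      linarith
    · choose ξ hξ using hint
      refine ⟨∑ r : Fin (f + 1), (-1) ^ (r : ℕ) * z (J.1.orderEmbOfFin J.2 r)
        * ξ (eraseIndex J r), ?_⟩
      rw [pluckerCoords_cons, Finset.mul_sum]
      push_cast
      refine Finset.sum_congr rfl fun r _ => ?_
      rw [hξ]
      simp only [Z, intVec_apply]
      ring
    -- The new first column has entries `≪ N ^ (-1/(n-f))`, its cofactors are bounded by 1, and `|s|
    -- ≤ H`.
    · rw [← pluckerCoords_cons_sub_sum Z b (fun k => (x k : ℝ)) J, pluckerCoords_cons, abs_mul]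
      have h3 : |∑ r : Fin (f + 1), (-1) ^ (r : ℕ)
          * (Z - ∑ k, (x k : ℝ) • b k) (J.1.orderEmbOfFin J.2 r) * pluckerCoords b (eraseIndex J r)|
          ≤ (f + 1) * (2 * (N : ℝ) ^ (-(1 / ((n : ℝ) - f)))) := by
        refine (Finset.abs_sum_le_sum_abs _ _).trans ?_
        have h4 : ∀ r ∈ (Finset.univ : Finset (Fin (f + 1))), |(-1) ^ (r : ℕ)
            * (Z - ∑ k, (x k : ℝ) • b k) (J.1.orderEmbOfFin J.2 r)
            * pluckerCoords b (eraseIndex J r)| ≤ 2 * (N : ℝ) ^ (-(1 / ((n : ℝ) - f))) := by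
          intro r _
          rw [abs_mul, abs_mul, abs_pow, abs_neg, abs_one, one_pow, one_mul]
          exact (mul_le_of_le_one_right (abs_nonneg _) (hb _)).trans (hsmall _)
        refine (Finset.sum_le_sum h4).trans ?_
        simp
      calc _ ≤ H * ((f + 1) * (2 * (K ^ (1 / ((n : ℝ) - f)) * H ^ (-(1 / ((n : ℝ) - f)))))) := by
            gcongr
            exact h3.trans (by gcongr)
        _ = (f + 1) * (2 * K ^ (1 / ((n : ℝ) - f))) * (H * H ^ (-(1 / ((n : ℝ) - f)))) := by ring
        _ = _ := by rw [hexp]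

/-- Schmidt's going-up theorem. -/
theorem exists_mem_rationalSubspaces_ge {j e : ℕ} (hje : j ≤ e) (he : e < n) :
    ∃ c : ℝ, 0 < c ∧ ∀ B ∈ rationalSubspaces n j, ∃ C ∈ rationalSubspaces n e, B ≤ C ∧
      height e C ≤ c * height j B ^ (((n : ℝ) - e) / ((n : ℝ) - j)) := by
  induction e, hje using Nat.le_induction with
  | base =>
    have hm : (n : ℝ) - j ≠ 0 := by
      have : (j : ℝ) < n := by exact_mod_cast he
      linarith
    exact ⟨1, one_pos, fun B hB => ⟨B, hB, le_rfl, by rw [div_self hm]; simp⟩⟩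
  | succ e hje ih =>
    obtain ⟨c, hc, h⟩ := ih (by omega)
    obtain ⟨c', hc', h'⟩ := exists_mem_rationalSubspaces_succ (n := n) (f := e) (by omega)
    have he' : ((e + 1 : ℕ) : ℝ) < n := by exact_mod_cast he
    have hj' : (j : ℝ) ≤ e := by exact_mod_cast hje
    have h1 : 0 < (n : ℝ) - e := by push_cast at he'; linarith
    have h2 : 0 < (n : ℝ) - j := by linarith
    have h3 : 0 < (n : ℝ) - (e + 1 : ℕ) := by linarith
    refine ⟨c' * c ^ (((n : ℝ) - (e + 1 : ℕ)) / ((n : ℝ) - e)), by positivity, fun B hB => ?_⟩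
    obtain ⟨C, hC, hBC, hCh⟩ := h B hB
    obtain ⟨D, hD, hCD, hDh⟩ := h' C hC
    have hB0 : 0 ≤ height j B := zero_le_one.trans (one_le_height hB)
    have hC0 : 0 ≤ height e C := zero_le_one.trans (one_le_height hC)
    refine ⟨D, hD, hBC.trans hCD, hDh.trans ?_⟩
    rw [mul_assoc]
    gcongr
    refine (Real.rpow_le_rpow hC0 hCh (by positivity)).trans_eq ?_
    rw [Real.mul_rpow hc.le (by positivity), ← Real.rpow_mul hB0]
    -- The exponents telescope.
    congr 2
    field_simp

end

section

variable {n : ℕ}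

/-! ### Simultaneous approximation -/

/-- Dirichlet's theorem on simultaneous approximation. -/
theorem exists_nat_forall_abs_mul_sub_le {ι : Type*} [Fintype ι] (y : ι → ℝ) {Q : ℕ} (hQ : 1 ≤ Q) :
    ∃ q : ℕ, 1 ≤ q ∧ q ≤ Q ^ Fintype.card ι ∧ ∃ z : ι → ℤ, ∀ i, |q * y i - z i| ≤ 1 / Q := by
  -- Pigeonhole among the multiples of `y` by `0, …, Q ^ card ι`.
  obtain ⟨a, b, hab, z, hz⟩ := exists_ne_forall_abs_sub_sub_le
    (fun (x : Fin (Q ^ Fintype.card ι + 1)) i => (x : ℝ) * y i) hQ (by simp)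
  rcases lt_or_gt_of_ne (Fin.val_ne_of_ne hab) with h | h
  · refine ⟨b - a, by omega, by omega, -z, fun i => ?_⟩
    have h1 := hz i
    rw [abs_sub_comm] at h1
    rw [Nat.cast_sub h.le]
    convert h1 using 2
    simp only [Pi.neg_apply]
    push_cast
    ring
  · refine ⟨a - b, by omega, by omega, z, fun i => ?_⟩
    have h1 := hz i
    rw [Nat.cast_sub h.le]
    convert h1 using 2
    ring

theorem norm_le_card_mul {Y : E n} {K : ℝ} (hK : 0 ≤ K) (h : ∀ i, |Y i| ≤ K) : ‖Y‖ ≤ n * K := by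
  rw [EuclideanSpace.norm_eq]
  simpa using sqrt_sum_sq_le hK (x := fun i => ‖Y i‖) (by simpa using h)

theorem abs_apply_le_norm (Y : E n) (i : Fin n) : |Y i| ≤ ‖Y‖ := by
  simpa using PiLp.norm_apply_le Y i

theorem IsEchelon.abs_apply_le_one {d : ℕ} {b : Fin d → E n} {g : Fin d → Fin n}
    (h : IsEchelon b g) (hb : ∀ g', |minor b g'| ≤ 1) (c : Fin d) (i : Fin n) : |b c i| ≤ 1 := by
  rw [← h.minor_update c i]
  exact hb _

theorem exists_isEchelon_span_eq {d : ℕ} {A : Submodule ℝ (E n)} (hA : Module.finrank ℝ A = d) :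
    ∃ (b : Fin d → E n) (g : Fin d → Fin n), IsEchelon b g ∧
      Submodule.span ℝ (Set.range b) = A ∧ ∀ c i, |b c i| ≤ 1 := by
  let β := Module.finBasisOfFinrankEq ℝ A hA
  have hβ : LinearIndependent ℝ (fun i => (β i : E n)) :=
    β.linearIndependent.map' A.subtype A.ker_subtype
  obtain ⟨b, g, hbg, hspan, hb⟩ := exists_isEchelon hβ
  refine ⟨b, g, hbg, hspan.trans ?_, hbg.abs_apply_le_one hb⟩
  refine Submodule.eq_of_le_of_finrank_eq (Submodule.span_le.2 ?_) ?_
  · rintro _ ⟨i, rfl⟩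
    exact (β i).2
  · rw [finrank_span_eq_card hβ, hA, Fintype.card_fin]

/-- Simultaneous approximation of `j` vectors of an echelon basis of `A` by integral vectors. -/
theorem exists_intVec_approx {d j : ℕ} (hjd : j ≤ d) {b : Fin d → E n} {g : Fin d → Fin n}
    (h : IsEchelon b g) {Q : ℕ} (hQ : 1 ≤ Q) :
    ∃ q : ℕ, 1 ≤ q ∧ q ≤ Q ^ (j * (n - d)) ∧ ∃ w : Fin j → Fin n → ℤ,
      (∀ c r, w c (g r) = if r = Fin.castLE hjd c then (q : ℤ) else 0) ∧
        ∀ c i, |q * b (Fin.castLE hjd c) i - w c i| ≤ 1 / Q := by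
  classical
  obtain ⟨q, hq1, hq, z, hz⟩ := exists_nat_forall_abs_mul_sub_le
    (fun p : Fin j × {i // i ∉ Set.range g} => b (Fin.castLE hjd p.1) p.2) hQ
  rw [Fintype.card_prod, Fintype.card_fin, card_notMem_range h.injective] at hq
  -- On the pivots `q` times the basis vector is already integral, so only the other `n - d` rows
  -- need approximation.
  let w : Fin j → Fin n → ℤ := fun c i =>
    if hi : i ∈ Set.range g then (if i = g (Fin.castLE hjd c) then (q : ℤ) else 0)
    else z (c, ⟨i, hi⟩)
  have hw : ∀ c r, w c (g r) = if r = Fin.castLE hjd c then (q : ℤ) else 0 := by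
    intro c r
    simp only [w, dif_pos (Set.mem_range_self r), h.injective.eq_iff]
  refine ⟨q, hq1, hq, w, hw, fun c i => ?_⟩
  by_cases hi : i ∈ Set.range g
  · obtain ⟨r, rfl⟩ := hi
    rw [hw, h]
    split_ifs <;> simp
  · have h1 : w c i = z (c, ⟨i, hi⟩) := by simp only [w, dif_neg hi]
    rw [h1]
    exact hz (c, ⟨i, hi⟩)

/-- Rational subspaces of dimension `j` all of whose vectors are close to `A`. -/
theorem exists_mem_rationalSubspaces_approx {d j : ℕ} (hjd : j ≤ d) {A : Submodule ℝ (E n)}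
    (hA : Module.finrank ℝ A = d) :
    ∃ K : ℝ, 0 < K ∧ ∀ Q : ℕ, 1 ≤ Q → ∃ q : ℕ, 1 ≤ q ∧ q ≤ Q ^ (j * (n - d)) ∧
      ∃ B ∈ rationalSubspaces n j, height j B ≤ K * (q : ℝ) ^ j ∧
        ∀ Y ∈ B, ∃ X ∈ A, ‖Y - X‖ ≤ K / (q * Q) * ‖Y‖ := by
  obtain ⟨b, g, hbg, hspan, hb⟩ := exists_isEchelon_span_eq hA
  set P : ℝ := ((Fintype.card (PluckerIndex n j) : ℕ) : ℝ)
  have hP : 0 ≤ P := Nat.cast_nonneg _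
  -- The first term serves the height bound, the second the distance bound, and 1 ensures
  -- positivity.
  refine ⟨P * (j.factorial * 2 ^ j) + n * j + 1, by positivity, fun Q hQ => ?_⟩
  set K := P * (j.factorial * 2 ^ j) + n * j + 1
  obtain ⟨q, hq1, hq, w, hwg, hw⟩ := exists_intVec_approx hjd hbg hQ
  have hq1' : (1 : ℝ) ≤ q := by exact_mod_cast hq1
  have hQ1' : (1 : ℝ) ≤ Q := by exact_mod_cast hQ
  have hcoord : ∀ (t : Fin j → ℝ) c,
      (∑ k, t k • intVec (w k)) (g (Fin.castLE hjd c)) = t c * q := by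
    intro t c
    have : ∀ k, Fin.castLE hjd c = Fin.castLE hjd k ↔ c = k := fun k =>
      (Fin.castLE_injective hjd).eq_iff
    simp [hwg, this]
  have hli : LinearIndependent ℝ (fun c => intVec (w c)) := by
    rw [Fintype.linearIndependent_iff]
    intro t ht c
    have h1 := hcoord t c
    rw [ht] at h1
    have h2 : t c * q = 0 := h1.symm
    exact (mul_eq_zero.1 h2).resolve_right (by positivity)
  refine ⟨q, hq1, hq, Submodule.span ℝ (Set.range fun c => intVec (w c)),
    span_intVec_mem_rationalSubspaces hli, ?_, fun Y hY => ?_⟩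
  · have hentry : ∀ c i, |(w c i : ℝ)| ≤ 2 * q := by
      intro c i
      have h1 := abs_sub_abs_le_abs_sub (w c i : ℝ) (q * b (Fin.castLE hjd c) i)
      have h2 := hw c i
      rw [abs_sub_comm] at h2
      have h3 : (1 : ℝ) / Q ≤ 1 := by rw [div_le_one (by positivity)]; exact hQ1'
      have h4 : |q * b (Fin.castLE hjd c) i| ≤ q := by
        rw [abs_mul, abs_of_nonneg (by positivity)]
        exact mul_le_of_le_one_right (by positivity) (hb _ _)
      linarith
    have hle := height_le_of_integral_of_abs_le hli one_ne_zero
      (K := j.factorial * (2 * q) ^ j)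
      (fun I => ⟨_, by rw [one_mul]; exact pluckerCoords_intVec w I⟩) (by positivity) fun I => by
        rw [one_mul]
        have := Matrix.det_le (abv := AbsoluteValue.abs (S := ℝ)) (x := 2 * (q : ℝ))
          (A := Matrix.of fun r c : Fin j => intVec (w c) (I.1.orderEmbOfFin I.2 r))
          (fun r c => hentry c _)
        simpa [pluckerCoords] using this
    refine hle.trans ?_
    rw [mul_pow, ← mul_assoc, ← mul_assoc, mul_assoc P]
    gcongr
    have : (0 : ℝ) ≤ n * j := by positivity
    simp only [K, P]
    linarith
  · obtain ⟨t, rfl⟩ := (Submodule.mem_span_range_iff_exists_fun ℝ).1 hY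
    set Y := ∑ k, t k • intVec (w k)
    -- The pivot coordinates of `Y` are `t c * q`; this is where the factor `1 / q` is gained.
    have ht : ∀ c, |t c| ≤ ‖Y‖ / q := by
      intro c
      rw [le_div_iff₀ (by positivity)]
      have h1 := abs_apply_le_norm Y (g (Fin.castLE hjd c))
      rwa [hcoord, abs_mul, Nat.abs_cast] at h1
    refine ⟨∑ k, t k • ((q : ℝ) • b (Fin.castLE hjd k)), ?_, ?_⟩
    · rw [← hspan]
      exact Submodule.sum_mem _ fun k _ => Submodule.smul_mem _ _ (Submodule.smul_mem _ _
        (Submodule.subset_span ⟨_, rfl⟩))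
    · have h1 : Y - ∑ k, t k • ((q : ℝ) • b (Fin.castLE hjd k))
          = ∑ k, t k • (intVec (w k) - (q : ℝ) • b (Fin.castLE hjd k)) := by
        rw [← Finset.sum_sub_distrib]
        exact Finset.sum_congr rfl fun k _ => (smul_sub _ _ _).symm
      rw [h1]
      have h2 : ∀ i, |(∑ k, t k • (intVec (w k) - (q : ℝ) • b (Fin.castLE hjd k))) i|
          ≤ j * (‖Y‖ / q * (1 / Q)) := by
        intro i
        have h3 : (∑ k, t k • (intVec (w k) - (q : ℝ) • b (Fin.castLE hjd k))) i
            = ∑ k, t k * ((w k i : ℝ) - q * b (Fin.castLE hjd k) i) := by simp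
        rw [h3]
        refine (Finset.abs_sum_le_sum_abs _ _).trans ?_
        have h4 : ∀ k ∈ (Finset.univ : Finset (Fin j)),
            |t k * ((w k i : ℝ) - q * b (Fin.castLE hjd k) i)| ≤ ‖Y‖ / q * (1 / Q) := by
          intro k _
          rw [abs_mul, abs_sub_comm]
          exact mul_le_mul (ht k) (hw k i) (abs_nonneg _) (by positivity)
        refine (Finset.sum_le_sum h4).trans ?_
        simp
      refine (norm_le_card_mul (by positivity) h2).trans ?_
      have h5 : (n : ℝ) * (j * (‖Y‖ / q * (1 / Q))) = n * j / (q * Q) * ‖Y‖ := by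
        field_simp
      rw [h5]
      gcongr
      have : 0 ≤ P * (j.factorial * 2 ^ j) := by positivity
      simp only [K]
      linarith

/-! ### The exponents -/

/-- Up to constants, `psi A C j` is at most `1/(qQ)` and `H(C) ^ β` at most `q^(1+κ)`, so the
inequality reduces to `q^κ ≪ Q`, which follows from `q ≤ Q^(j(n-d))`. -/
theorem infinite_of_exponent_lt {d e j : ℕ} (hj : 1 ≤ j) (hjd : j ≤ d) (hje : j ≤ e) (hen : e < n)
    {A : Submodule ℝ (E n)} (hA : A ∈ irrationalSubspaces n d e j) {β κ : ℝ} (hβ : 0 < β)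
    (hκ : 0 < κ) (hκ1 : ((j * (n - d) : ℕ) : ℝ) * κ < 1)
    (hβκ : j * (((n : ℝ) - e) / ((n : ℝ) - j)) * β = 1 + κ) :
    {B ∈ rationalSubspaces n e | psi A B j ≤ 1 / height e B ^ β}.Infinite := by
  set S := {B ∈ rationalSubspaces n e | psi A B j ≤ 1 / height e B ^ β}
  set M := j * (n - d)
  set θ := ((n : ℝ) - e) / ((n : ℝ) - j)
  have hen' : (e : ℝ) < n := by exact_mod_cast hen
  have hje' : (j : ℝ) ≤ e := by exact_mod_cast hje
  have hθ : 0 < θ := div_pos (by linarith) (by linarith)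
  obtain ⟨K, hK, happrox⟩ := exists_mem_rationalSubspaces_approx hjd hA.1
  obtain ⟨c, hc, hup⟩ := exists_mem_rationalSubspaces_ge hje hen
  have hmem : ∀ᶠ Q : ℕ in atTop, ∃ C ∈ S, psi A C j ≤ K / Q := by
    have hlim : Tendsto (fun Q : ℕ => (Q : ℝ) ^ (1 - M * κ)) atTop atTop :=
      (tendsto_rpow_atTop (by linarith)).comp tendsto_natCast_atTop_atTop
    -- For large `Q` the positive power `Q ^ (1 - M * κ)` absorbs every multiplicative constant.
    filter_upwards [hlim.eventually_ge_atTop (K * (c * K ^ θ) ^ β), eventually_ge_atTop 1]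
      with Q hQ hQ1
    obtain ⟨q, hq1, hqQ, B, hB, hBH, hBA⟩ := happrox Q hQ1
    obtain ⟨C, hC, hBC, hCH⟩ := hup B hB
    have hq1' : (1 : ℝ) ≤ q := by exact_mod_cast hq1
    have hQ1' : (1 : ℝ) ≤ Q := by exact_mod_cast hQ1
    have hq0 : (0 : ℝ) < q := by linarith
    have hQ0 : (0 : ℝ) < Q := by linarith
    have hpsi : psi A C j ≤ K / (q * Q) :=
      psi_le_of_forall_mem_exists_norm_sub_le hj (hjd.trans hA.1.ge) hB.2.ge hBC hBA
    have hC0 : 0 < height e C := zero_lt_one.trans_le (one_le_height hC)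
    have hB0 : 0 < height j B := zero_lt_one.trans_le (one_le_height hB)
    refine ⟨C, ⟨hC, hpsi.trans ?_⟩, hpsi.trans ?_⟩
    · have h1 : height e C ≤ c * K ^ θ * (q : ℝ) ^ (j * θ) := by
        refine hCH.trans ?_
        rw [mul_assoc, Real.rpow_mul hq0.le, Real.rpow_natCast,
          ← Real.mul_rpow hK.le (by positivity)]
        gcongr
      have h2 : height e C ^ β ≤ (c * K ^ θ) ^ β * (q * (q : ℝ) ^ κ) := by
        refine (Real.rpow_le_rpow hC0.le h1 hβ.le).trans_eq ?_
        rw [Real.mul_rpow (by positivity) (by positivity), ← Real.rpow_mul hq0.le, hβκ,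
          Real.rpow_add hq0, Real.rpow_one]
      have h3 : (q : ℝ) ^ κ ≤ (Q : ℝ) ^ (M * κ) := by
        rw [Real.rpow_mul hQ0.le, Real.rpow_natCast]
        exact Real.rpow_le_rpow hq0.le (by exact_mod_cast hqQ) hκ.le
      have h4 : (Q : ℝ) ^ (1 - M * κ) * (Q : ℝ) ^ (M * κ) = Q := by
        rw [← Real.rpow_add hQ0, sub_add_cancel, Real.rpow_one]
      rw [div_le_div_iff₀ (by positivity) (by positivity), one_mul]
      calc K * height e C ^ β ≤ K * ((c * K ^ θ) ^ β * (q * (q : ℝ) ^ κ)) := by gcongr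
        _ = q * (K * (c * K ^ θ) ^ β * (q : ℝ) ^ κ) := by ring
        _ ≤ q * ((Q : ℝ) ^ (1 - M * κ) * (Q : ℝ) ^ (M * κ)) := by gcongr
        _ = q * Q := by rw [h4]
    · gcongr
      exact le_mul_of_one_le_left hQ0.le hq1'
  -- A finite set would have a smallest angle, positive by irrationality, contradicting angles at
  -- most `K / Q`.
  intro hfin
  obtain ⟨_, C₀, hC₀, -⟩ := hmem.exists
  obtain ⟨C₁, hC₁, hmin⟩ := Set.exists_min_image S (fun C => psi A C j) hfin ⟨C₀, hC₀⟩
  have hpos := psi_pos_of_mem_irrationalSubspaces hj hjd hje hA hC₁.1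
  have hsmall : ∀ᶠ Q : ℕ in atTop, K / (Q : ℝ) < psi A C₁ j :=
    (tendsto_const_div_atTop_nhds_zero_nat K).eventually_lt_const hpos
  obtain ⟨Q, ⟨C, hC, hCQ⟩, hQ⟩ := (hmem.and hsmall).exists
  exact absurd (hmin C hC) (not_le.2 (hCQ.trans_lt hQ))

theorem le_muInf {d e j : ℕ} (hd : 1 ≤ d) (he : 1 ≤ e) (hde : d + e ≤ n) (hj : 1 ≤ j)
    (hjde : j ≤ min d e) :
    (((((n : ℝ) - j) * (j * n - j * d + (j : ℝ) ^ 2 / 2 + (j : ℝ) / 2 + 1)) /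
      ((j : ℝ) ^ 2 * ((n : ℝ) - e) * ((n : ℝ) - d + (j : ℝ) / 2 + 1 / 2)) : ℝ) : EReal)
        ≤ muInf n d e j := by
  have hjd : j ≤ d := hjde.trans (min_le_left _ _)
  have hje : j ≤ e := hjde.trans (min_le_right _ _)
  have hj' : (1 : ℝ) ≤ j := by exact_mod_cast hj
  have hje' : (j : ℝ) ≤ e := by exact_mod_cast hje
  have hd' : (d : ℝ) < n := by exact_mod_cast (by omega : d < n)
  have he' : (e : ℝ) < n := by exact_mod_cast (by omega : e < n)
  have h1 : 0 < (n : ℝ) - d := by linarith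
  have h2 : 0 < (n : ℝ) - e := by linarith
  have h3 : 0 < (n : ℝ) - j := by linarith
  have h4 : (0 : ℝ) < j := by linarith
  have h5 : 0 < (n : ℝ) - d + (j : ℝ) / 2 + 1 / 2 := by positivity
  have h6 : 0 < (j : ℝ) * n - j * d + (j : ℝ) ^ 2 / 2 + (j : ℝ) / 2 + 1 := by
    have : (j : ℝ) * n - j * d = j * (n - d) := by ring
    rw [this]
    positivity
  refine le_iInf₂ fun A hA => le_sSup ⟨_, ⟨by positivity, ?_⟩, rfl⟩
  -- This `κ` is the one for which `jθβ = 1 + κ` holds with the stated `β`; it is below `1/(j(n-d))`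
  -- because `(j+1)/2 > 0`.
  refine infinite_of_exponent_lt hj hjd hje (by omega) hA (by positivity)
    (κ := 1 / (j * ((n : ℝ) - d + (j : ℝ) / 2 + 1 / 2))) (by positivity) ?_ ?_
  · rw [mul_one_div, div_lt_one (by positivity), Nat.cast_mul, Nat.cast_sub (by omega)]
    gcongr
    linarith
  · field_simp

/-! ### Limit of the lower bound -/

theorem tendsto_lowerBound (d e : ℝ) {j : ℝ} (hj : j ≠ 0) :
    Tendsto (fun n : ℕ => (((n : ℝ) - j) * (j * n - j * d + j ^ 2 / 2 + j / 2 + 1)) /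
      (j ^ 2 * ((n : ℝ) - e) * ((n : ℝ) - d + j / 2 + 1 / 2))) atTop (𝓝 (1 / j)) := by
  -- The bound after dividing numerator and denominator by `n²`, with `u = 1/n`; it is continuous at
  -- `u = 0`.
  let F : ℝ → ℝ := fun u => ((1 - j * u) * (j + (-(j * d) + j ^ 2 / 2 + j / 2 + 1) * u)) /
    (j ^ 2 * (1 - e * u) * (1 + (-d + j / 2 + 1 / 2) * u))
  have hF : ContinuousAt F 0 := by
    refine ContinuousAt.div (by fun_prop) (by fun_prop) ?_
    simpa using hj
  have hF0 : F 0 = 1 / j := by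
    simp only [F]
    field_simp
    simp
  have h1 : Tendsto (fun n : ℕ => F ((n : ℝ)⁻¹)) atTop (𝓝 (1 / j)) := by
    rw [← hF0]
    exact hF.tendsto.comp tendsto_inv_atTop_nhds_zero_nat
  refine h1.congr' ?_
  filter_upwards [eventually_ge_atTop 1] with n hn
  have hn0 : (n : ℝ) ≠ 0 := by
    have : (1 : ℝ) ≤ n := by exact_mod_cast hn
    positivity
  simp only [F]
  rw [← mul_div_mul_right _ _ (pow_ne_zero 2 hn0)]
  congr 1
  · field_simp
    ring
  · field_simp
    ring

end

end SubspaceApprox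

end

theorem mainTheorem3 :
    (∀ n d e j : ℕ, 4 ≤ n → 1 ≤ d → 1 ≤ e → d + e ≤ n → 1 ≤ j → j ≤ min d e →
      (((((n : ℝ) - j) * (j * n - j * d + (j : ℝ) ^ 2 / 2 + (j : ℝ) / 2 + 1)) /
          ((j : ℝ) ^ 2 * ((n : ℝ) - e) * ((n : ℝ) - d + (j : ℝ) / 2 + 1 / 2)) : ℝ) : EReal)
        ≤ SubspaceApprox.muInf n d e j) ∧
    (∀ n d : ℕ, 4 ≤ n → 1 ≤ d → 2 * d ≤ n →
      (((2 * (d : ℝ) * n - (d : ℝ) ^ 2 + d + 2) /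
          (2 * (d : ℝ) ^ 2 * n - (d : ℝ) ^ 3 + (d : ℝ) ^ 2) : ℝ) : EReal)
        ≤ SubspaceApprox.muInf n d d d) ∧
    (∀ d e j : ℕ, 1 ≤ j → j ≤ min d e →
      Tendsto (fun n : ℕ =>
        (((n : ℝ) - j) * (j * n - j * d + (j : ℝ) ^ 2 / 2 + (j : ℝ) / 2 + 1)) /
          ((j : ℝ) ^ 2 * ((n : ℝ) - e) * ((n : ℝ) - d + (j : ℝ) / 2 + 1 / 2)))
        atTop (𝓝 (1 / (j : ℝ)))) := by
  refine ⟨fun n d e j _ hd he hde hj hjde => SubspaceApprox.le_muInf hd he hde hj hjde,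
    fun n d _ hd hdn => ?_, fun d e j hj _ => SubspaceApprox.tendsto_lowerBound d e ?_⟩
  · have h := SubspaceApprox.le_muInf (n := n) hd hd (by omega) hd (le_min le_rfl le_rfl)
    convert h using 2
    have h1 : (1 : ℝ) ≤ d := by exact_mod_cast hd
    have h2 : 2 * (d : ℝ) ≤ n := by exact_mod_cast hdn
    -- For `j = e = d` the factors `n - j` and `n - e` coincide and cancel.
    have h3 : (n : ℝ) - d ≠ 0 := by
      have : 0 < (n : ℝ) - d := by linarith
      exact this.ne'
    have h4 : (n : ℝ) - d + (d : ℝ) / 2 + 1 / 2 ≠ 0 := by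
      have : 0 < (n : ℝ) - d + (d : ℝ) / 2 + 1 / 2 := by linarith
      exact this.ne'
    have h5 : (d : ℝ) ≠ 0 := by positivity
    have h6 : 2 * (d : ℝ) ^ 2 * n - (d : ℝ) ^ 3 + (d : ℝ) ^ 2
        = 2 * (d : ℝ) ^ 2 * ((n : ℝ) - d + (d : ℝ) / 2 + 1 / 2) := by ring
    rw [h6, div_eq_div_iff (by positivity) (by positivity)]
    ring
  · have : (1 : ℝ) ≤ j := by exact_mod_cast hj
    positivity
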